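/- For $g\in L^2(\mathbb{R}^d)$ with $\|g\|_2=1$ and $f\in L^2(\mathbb{R}^d)$ let $$V_gf(x,\xi)=\int_{\mathbb{R}^d}f(t)\,\overline{g(t-x)}\,e^{-2\pi i\xi\cdot t}\,dt,\qquad (x,\xi)\in\mathbb{R}^d\times\mathbb{R}^d=\mathbb{R}^{2d},$$ and let $M^*(\mathbb{R}^d)$ be the class of all $g\in L^2(\mathbb{R}^d)$ with $\|g\|_{M^*}^2:=\int_{\mathbb{R}^{2d}}|z|\,|V_gg(z)|^2\,dz<\infty$. For a compact set $\Omega\subset\mathbb{R}^{2d}$ let $H_\Omega$ be the time-frequency localization operator $$H_\Omega f(t)=\int_\Omega V_gf(x,\xi)\,g(t-x)\,e^{2\pi i\xi\cdot t}\,dx\,d\xi,\qquad f\in L^2(\mathbb{R}^d).$$ It can be diagonalized as $H_\Omega f=\sum_{k\ge1}\lambda_k\langle f,h_k\rangle h_k$, where $\lambda_1\ge\lambda_2\ge\dots>0$ are its non-zero eigenvalues, counted with multiplicity, and $\{h_k\}$ is a corresponding orthonormal system of eigenfunctions. Let $|\Omega|$ denote the Lebesgue measure of $\Omega$ and $1_\Omega$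 its characteristic function, and for any such system put $$\rho_\Omega(z)=\sum_{k=1}^{\lceil|\Omega|\rceil}|V_gh_k(z)|^2,\qquad z\in\mathbb{R}^{2d}.$$ The perimeter of $\Omega$ is $$|\partial\Omega|:=\sup\Big\{\int_\Omega\operatorname{div}\varphi\,dz:\ \varphi\in C^1_c(\mathbb{R}^{2d},\mathbb{R}^{2d}),\ |\varphi(z)|\le1\text{ for all }z\Big\}\in[0,\infty].$$ **Theorem 1.5.** There is an absolute constant $C>0$ such that the following holds for every $d$. Let $g\in M^*(\mathbb{R}^d)$ with $\|g\|_2=1$, let $\Omega\subset\mathbb{R}^{2d}$ be a compact set with finite perimeter, and assume that $\|g\|_{M^*}^2\,|\partial\Omega|\ge1$. Then a diagonalization of $H_\Omega$ as above exists, and for each choice of it and every $\delta>0$ $$\big|\{z\in\mathbb{R}^{2d}:\ |\rho_\Omega(z)-1_\Omega(z)|>\delta\}\big|\ \le\ \frac{C}{\delta^2}\,\|g\|_{M^*}^2\,|\partial\Omega|.$$ -/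

import Mathlib

open MeasureTheory
open scoped ENNReal ComplexConjugate

noncomputable section

namespace AccSpec

/-- `ℝ^d` with the Euclidean norm and Lebesgue measure. -/
abbrev Sp (d : ℕ) : Type := EuclideanSpace ℝ (Fin d)

/-- The time-frequency plane `ℝ^{2d}` with the Euclidean norm and Lebesgue measure; the coordinates
of `z = (x, ξ)` are indexed by `Fin d ⊕ Fin d`. -/
abbrev Phase (d : ℕ) : Type := EuclideanSpace ℝ (Fin d ⊕ Fin d)

/-- The Hilbert space `L²(ℝ^d)` of complex-valued functions. -/
abbrev L2 (d : ℕ) : Type := Lp ℂ 2 (volume : Measure (Sp d))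

/-- The time component `x` of `z = (x, ξ)`. -/
def timePart {d : ℕ} (z : Phase d) : Sp d := WithLp.toLp 2 fun i => z (Sum.inl i)

/-- The frequency component `ξ` of `z = (x, ξ)`. -/
def freqPart {d : ℕ} (z : Phase d) : Sp d := WithLp.toLp 2 fun i => z (Sum.inr i)

/-- The short-time Fourier transform
`V_g f (x, ξ) = ∫ f(t) conj(g(t - x)) exp(-2πi ξ·t) dt`. -/
def stft {d : ℕ} (g f : L2 d) (z : Phase d) : ℂ :=
  ∫ t : Sp d, f t * conj (g (t - timePart z)) *
    Complex.exp (-(2 * Real.pi * Complex.I * (inner ℝ (freqPart z) t : ℝ)))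

/-- The time-frequency localization operator applied to `f`, as a function of `t`:
`∫_Ω V_g f (x, ξ) g(t - x) exp(2πi ξ·t) dx dξ`. -/
def locFun {d : ℕ} (g : L2 d) (Ω : Set (Phase d)) (f : L2 d) (t : Sp d) : ℂ :=
  ∫ z in Ω, stft g f z * g (t - timePart z) *
    Complex.exp (2 * Real.pi * Complex.I * (inner ℝ (freqPart z) t : ℝ))

/-- `lam 0 ≥ lam 1 ≥ …` are the non-zero eigenvalues (with multiplicity, in non-increasing order)
of the time-frequency localization operator with window `g` and domain `Ω`, and `h 0, h 1, …` is a
corresponding orthonormal system of eigenfunctions, so that the operator is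
`f ↦ ∑ₖ lam k ⟨f, h k⟩ h k`. If there are only finitely many non-zero eigenvalues, both lists are
continued by zeros. (`inner ℂ (h k) f` is the integral of `f * conj (h k)`.) -/
structure IsEigensystem {d : ℕ} (g : L2 d) (Ω : Set (Phase d))
    (lam : ℕ → ℝ) (h : ℕ → L2 d) : Prop where
  nonneg : ∀ k, 0 ≤ lam k
  antitone : Antitone lam
  orthonormal : Orthonormal ℂ (fun k : {k : ℕ // 0 < lam k} => h k)
  eq_zero : ∀ k, lam k = 0 → h k = 0
  diagonal : ∀ f : L2 d, ∃ F : L2 d, (F =ᵐ[volume] locFun g Ω f) ∧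
    HasSum (fun k : ℕ => ((lam k : ℂ) * inner ℂ (h k) f) • h k) F

/-- The accumulated spectrogram `∑ |V_g h_k (z)|²` over the first `⌈|Ω|⌉` functions `h_k`. -/
def accSpec {d : ℕ} (g : L2 d) (Ω : Set (Phase d)) (h : ℕ → L2 d) (z : Phase d) : ℝ :=
  ∑ k ∈ Finset.range ⌈(volume : Measure (Phase d)).real Ω⌉₊, ‖stft g (h k) z‖ ^ 2

/-- `‖g‖²_{M*} = ∫ |z| |V_g g (z)|² dz`, with values in `[0, ∞]`. -/
def mStarSq {d : ℕ} (g : L2 d) : ℝ≥0∞ :=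
  ∫⁻ z : Phase d, ENNReal.ofReal (‖z‖ * ‖stft g g z‖ ^ 2)

/-- The divergence of a vector field. -/
def divergence {ι : Type*} [Fintype ι] [DecidableEq ι]
    (φ : EuclideanSpace ℝ ι → EuclideanSpace ℝ ι) (x : EuclideanSpace ℝ ι) : ℝ :=
  ∑ i, fderiv ℝ φ x (EuclideanSpace.single i 1) i

/-- The total variation `sup ∫ f div φ` over compactly supported `C¹` vector fields `φ` with
`|φ| ≤ 1`, with values in `[0, ∞]` (the field `φ = 0` shows that the supremum is not negative). -/
def variation {ι : Type*} [Fintype ι] [DecidableEq ι] (f : EuclideanSpace ℝ ι → ℝ) : ℝ≥0∞ :=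
  ⨆ φ ∈ {φ : EuclideanSpace ℝ ι → EuclideanSpace ℝ ι |
      ContDiff ℝ 1 φ ∧ HasCompactSupport φ ∧ ∀ x, ‖φ x‖ ≤ 1},
    ENNReal.ofReal (∫ x, f x * divergence φ x)

/-- The perimeter of a set: the total variation of its characteristic function. -/
def perimeter {ι : Type*} [Fintype ι] [DecidableEq ι] (Ω : Set (EuclideanSpace ℝ ι)) : ℝ≥0∞ :=
  variation (Ω.indicator fun _ => (1 : ℝ))

end AccSpec

end

noncomputable section

namespace AccSpec

/-! ### Time-frequency shifts and the localization operator. -/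

section

open Filter Topology

variable {d : ℕ}

/-! Write `atom g z` for the window shifted by `z`, so that `stft g f z` is the inner product of `f`
with `atom g z`. The localization operator is the integral over `Ω` of the rank-one operators built
on the atoms; it is compact and symmetric, with quadratic form `f ↦ ∫_Ω |V_g f|²`. The spectral
theorem and Bessel's inequality give an eigenbasis with summable eigenvalues, which can be listed in
decreasing order (`exists_isEigensystem`).

For the estimate, `λ_k = ∫_Ω |V_g h_k|²`, while Moyal's identity (`lintegral_enorm_sq_stft`) gives
total mass 1 whenever `λ_k > 0`. Hence `λ_k ≤ 1`, and `1 - λ_k` is then the mass outside `Ω`.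
Evaluating the quadratic form at `atom g z` gives `∑ λ_k |V_g h_k(z)|² = ∫_Ω |V_g g(w - z)|² dw`
(`tsum_stft`). Integrated over the whole plane this is the trace formula `∑ λ_k = |Ω|`; integrated
over the complement of `Ω` it shows that `S = ∑ λ_k (1 - λ_k)` is the interaction of `Ω` with its
complement under the kernel `|V_g g|²`. Since a translation by `v` moves at most `|v| |∂Ω|` of `Ω`
out of itself, `S ≤ ‖g‖²_{M*} |∂Ω|`.

Bessel gives `0 ≤ ρ ≤ 1`. With `N = ⌈|Ω|⌉`, the `L¹` error is therefore `|Ω| - ∑_{k<N} λ_k` inside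
`Ω` and at most `N - ∑_{k<N} λ_k` outside. The first is at most `S` by a rearrangement argument
(`tail_le_of_hasSum`), the second exceeds it by at most 1. So the `L¹` error is at most `1 + 2
‖g‖²_{M*} |∂Ω|`, and Markov's inequality finishes. -/

lemma continuous_timePart : Continuous (timePart : Phase d → Sp d) := by
  unfold timePart; fun_prop

lemma continuous_freqPart : Continuous (freqPart : Phase d → Sp d) := by
  unfold freqPart; fun_prop

@[simp] lemma timePart_sub (z w : Phase d) : timePart (z - w) = timePart z - timePart w := rfl

@[simp] lemma freqPart_sub (z w : Phase d) : freqPart (z - w) = freqPart z - freqPart w := rfl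

/-- The character `t ↦ exp(2πi ξ·t)`. -/
def chi (ξ t : Sp d) : ℂ := Complex.exp (2 * Real.pi * Complex.I * (inner ℝ ξ t : ℝ))

lemma norm_chi (ξ t : Sp d) : ‖chi ξ t‖ = 1 := by
  have : chi ξ t = Complex.exp (((2 * Real.pi * inner ℝ ξ t : ℝ) : ℂ) * Complex.I) := by
    unfold chi; congr 1; push_cast; ring
  rw [this, Complex.norm_exp_ofReal_mul_I]

lemma conj_chi (ξ t : Sp d) :
    conj (chi ξ t) = Complex.exp (-(2 * Real.pi * Complex.I * (inner ℝ ξ t : ℝ))) := by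
  unfold chi
  rw [← Complex.exp_conj]
  simp [Complex.conj_ofNat]

lemma chi_sub_left (ξ η t : Sp d) : chi (ξ - η) t = chi ξ t * conj (chi η t) := by
  rw [conj_chi, chi, chi, ← Complex.exp_add, inner_sub_left]
  congr 1; push_cast; ring

lemma chi_add_right (ξ t s : Sp d) : chi ξ (t + s) = chi ξ t * chi ξ s := by
  rw [chi, chi, chi, ← Complex.exp_add, inner_add_right]
  congr 1; push_cast; ring

lemma continuous_chi : Continuous fun p : Sp d × Sp d => chi p.1 p.2 := by
  unfold chi; fun_prop

/-- Translation on `L²`. -/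
def trans (x : Sp d) (g : L2 d) : L2 d :=
  Lp.compMeasurePreserving (fun t => t - x) (measurePreserving_sub_right volume x) g

lemma trans_ae (x : Sp d) (g : L2 d) : trans x g =ᵐ[volume] fun t => g (t - x) :=
  Lp.coeFn_compMeasurePreserving g _

lemma norm_trans (x : Sp d) (g : L2 d) : ‖trans x g‖ = ‖g‖ :=
  Lp.norm_compMeasurePreserving g _

lemma continuous_trans (g : L2 d) : Continuous fun x => trans x g := by
  let G : Sp d → C(Sp d, Sp d) := fun x => ⟨fun t => t - x, by fun_prop⟩
  have hG : Continuous G := ContinuousMap.continuous_of_continuous_uncurry _ (by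
    simp only [G, ContinuousMap.coe_mk, Function.uncurry_def]; fun_prop)
  exact (continuous_const (y := g)).compMeasurePreservingLp hG
    (fun x => measurePreserving_sub_right volume x) (by simp)

lemma memLp_chi_mul (ξ : Sp d) (g : L2 d) : MemLp (fun t => chi ξ t * g t) 2 volume := by
  refine (Lp.memLp g).of_le ?_ (ae_of_all _ fun t => by simp [norm_chi])
  exact (continuous_chi.comp (by fun_prop : Continuous fun t : Sp d => (ξ, t))).aestronglyMeasurable.mul
    (Lp.aestronglyMeasurable g)

/-- Modulation on `L²`. -/
def modul (ξ : Sp d) (g : L2 d) : L2 d := (memLp_chi_mul ξ g).toLp _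

lemma modul_ae (ξ : Sp d) (g : L2 d) : modul ξ g =ᵐ[volume] fun t => chi ξ t * g t :=
  MemLp.coeFn_toLp _

lemma norm_modul (ξ : Sp d) (g : L2 d) : ‖modul ξ g‖ = ‖g‖ := by
  rw [Lp.norm_def, Lp.norm_def]
  congr 1
  refine eLpNorm_congr_norm_ae ?_
  filter_upwards [modul_ae ξ g] with t ht
  rw [ht]; simp [norm_chi]

lemma modul_sub (ξ : Sp d) (g h : L2 d) : modul ξ (g - h) = modul ξ g - modul ξ h := by
  apply Lp.ext
  filter_upwards [modul_ae ξ g, modul_ae ξ h, modul_ae ξ (g - h), Lp.coeFn_sub g h,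
    Lp.coeFn_sub (modul ξ g) (modul ξ h)] with t h1 h2 h3 h4 h5
  rw [h3, h5, h4, Pi.sub_apply, Pi.sub_apply, h1, h2, mul_sub]

lemma inner_modul_modul (ξ η : Sp d) (g : L2 d) :
    inner ℂ (modul η g) (modul ξ g) = ∫ t, chi (ξ - η) t * (‖g t‖ ^ 2 : ℝ) := by
  rw [L2.inner_def]
  refine integral_congr_ae ?_
  filter_upwards [modul_ae ξ g, modul_ae η g] with t h1 h2
  rw [h1, h2, RCLike.inner_apply, chi_sub_left, map_mul, ← Complex.normSq_eq_norm_sq,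
    ← Complex.mul_conj]
  ring

/-- Expanding the square, `‖M_ξ g - M_ξ₀ g‖²` is `2‖g‖²` minus twice the real part of `∫ χ_{ξ₀-ξ}
|g|²`, which is continuous in `ξ` by dominated convergence. -/
lemma continuous_modul (g : L2 d) : Continuous fun ξ => modul ξ g := by
  have hI : Continuous fun ξ : Sp d => ∫ t, chi ξ t * (‖g t‖ ^ 2 : ℝ) := by
    refine continuous_of_dominated (bound := fun t => ‖g t‖ ^ 2) (fun ξ => ?_) (fun ξ => ?_) ?_ ?_
    · exact (continuous_chi.comp
        (by fun_prop : Continuous fun t : Sp d => (ξ, t))).aestronglyMeasurable.mul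
        (Complex.continuous_ofReal.comp_aestronglyMeasurable
          ((Lp.aestronglyMeasurable g).norm.pow 2))
    · exact ae_of_all _ fun t => by simp [norm_chi]
    · exact (memLp_two_iff_integrable_sq_norm (Lp.aestronglyMeasurable g)).1 (Lp.memLp g)
    · refine ae_of_all _ fun t => ?_
      exact (continuous_chi.comp (by fun_prop : Continuous fun ξ : Sp d => (ξ, t))).mul
        continuous_const
  rw [continuous_iff_continuousAt]
  intro ξ₀
  rw [ContinuousAt, tendsto_iff_norm_sub_tendsto_zero]
  have key : ∀ ξ, ‖modul ξ g - modul ξ₀ g‖ ^ 2 =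
      2 * ‖g‖ ^ 2 - 2 * (∫ t, chi (ξ₀ - ξ) t * (‖g t‖ ^ 2 : ℝ)).re := by
    intro ξ
    rw [@norm_sub_sq ℂ, inner_modul_modul, norm_modul, norm_modul, RCLike.re_eq_complex_re]
    ring
  have h0 : ‖g‖ ^ 2 = (∫ t, chi (ξ₀ - ξ₀) t * (‖g t‖ ^ 2 : ℝ)).re := by
    rw [← inner_modul_modul, inner_self_eq_norm_sq_to_K, norm_modul]
    norm_cast
  have hlim : Tendsto (fun ξ => ‖modul ξ g - modul ξ₀ g‖ ^ 2) (𝓝 ξ₀) (𝓝 0) := by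
    simp_rw [key]
    have hc : Continuous fun ξ : Sp d =>
        2 * ‖g‖ ^ 2 - 2 * (∫ t, chi (ξ₀ - ξ) t * (‖g t‖ ^ 2 : ℝ)).re :=
      continuous_const.sub (continuous_const.mul
        (Complex.continuous_re.comp (hI.comp (by fun_prop : Continuous fun ξ => ξ₀ - ξ))))
    have := hc.tendsto ξ₀
    rwa [← h0, sub_self] at this
  have := (Real.continuous_sqrt.tendsto 0).comp hlim
  simpa [Function.comp_def] using this

/-- The time-frequency shift `t ↦ g(t - x) exp(2πi ξ·t)` of the window. -/
def atom (g : L2 d) (z : Phase d) : L2 d := modul (freqPart z) (trans (timePart z) g)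

lemma atom_ae (g : L2 d) (z : Phase d) :
    atom g z =ᵐ[volume] fun t => chi (freqPart z) t * g (t - timePart z) := by
  filter_upwards [modul_ae (freqPart z) (trans (timePart z) g), trans_ae (timePart z) g]
    with t h1 h2
  rw [atom, h1, h2]

lemma norm_atom (g : L2 d) (z : Phase d) : ‖atom g z‖ = ‖g‖ := by
  rw [atom, norm_modul, norm_trans]

lemma continuous_atom (g : L2 d) : Continuous (atom g) := by
  rw [continuous_iff_continuousAt]
  intro z₀
  rw [ContinuousAt, tendsto_iff_norm_sub_tendsto_zero]
  have h1 : Tendsto (fun z => ‖trans (timePart z) g - trans (timePart z₀) g‖) (𝓝 z₀) (𝓝 0) := by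
    rw [← tendsto_iff_norm_sub_tendsto_zero]
    exact ((continuous_trans g).comp continuous_timePart).tendsto z₀
  have h2 : Tendsto (fun z => ‖modul (freqPart z) (trans (timePart z₀) g) -
      modul (freqPart z₀) (trans (timePart z₀) g)‖) (𝓝 z₀) (𝓝 0) := by
    rw [← tendsto_iff_norm_sub_tendsto_zero]
    exact ((continuous_modul _).comp continuous_freqPart).tendsto z₀
  refine squeeze_zero (fun _ => norm_nonneg _) (fun z => ?_) (by simpa using h1.add h2)
  calc ‖atom g z - atom g z₀‖
      = ‖modul (freqPart z) (trans (timePart z) g - trans (timePart z₀) g) +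
          (modul (freqPart z) (trans (timePart z₀) g) -
            modul (freqPart z₀) (trans (timePart z₀) g))‖ := by
        rw [modul_sub, atom, atom]; congr 1; abel
    _ ≤ _ := by
        refine (norm_add_le _ _).trans ?_
        rw [norm_modul]

lemma stft_eq_inner (g f : L2 d) (z : Phase d) : stft g f z = inner ℂ (atom g z) f := by
  rw [stft, L2.inner_def]
  refine integral_congr_ae ?_
  filter_upwards [atom_ae g z] with t ht
  rw [ht, RCLike.inner_apply, map_mul, conj_chi]
  ring

lemma continuous_stft (g f : L2 d) : Continuous (stft g f) := by
  have : stft g f = fun z => inner ℂ (atom g z) f := funext (stft_eq_inner g f)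
  rw [this]
  exact (continuous_atom g).inner continuous_const

lemma norm_stft_le (g f : L2 d) (z : Phase d) : ‖stft g f z‖ ≤ ‖g‖ * ‖f‖ := by
  rw [stft_eq_inner, ← norm_atom g z]
  exact norm_inner_le_norm _ _

/-- Covariance of time-frequency shifts: substituting `t + x` for `t`, with `x` the time part of
`z`, leaves only a unimodular phase. This is what turns the reproducing kernel into a convolution
kernel. -/
lemma norm_inner_atom_atom (g : L2 d) (w z : Phase d) :
    ‖(inner ℂ (atom g w) (atom g z) : ℂ)‖ = ‖stft g g (w - z)‖ := by
  have h1 : (inner ℂ (atom g w) (atom g z) : ℂ) = ∫ t, chi (freqPart z - freqPart w) t *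
      (g (t - timePart z) * conj (g (t - timePart w))) := by
    rw [L2.inner_def]
    refine integral_congr_ae ?_
    filter_upwards [atom_ae g w, atom_ae g z] with t hw hz
    rw [hw, hz, RCLike.inner_apply, chi_sub_left, map_mul]
    ring
  have h2 : stft g g (w - z) = ∫ t, chi (freqPart z - freqPart w) t *
      (g t * conj (g (t - timePart (w - z)))) := by
    rw [stft]
    refine integral_congr_ae (ae_of_all _ fun t => ?_)
    simp only [← conj_chi, freqPart_sub, chi_sub_left, map_mul, Complex.conj_conj]
    ring
  have h3 : (inner ℂ (atom g w) (atom g z) : ℂ) =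
      chi (freqPart z - freqPart w) (timePart z) * stft g g (w - z) := by
    rw [h1, h2, ← integral_add_right_eq_self _ (timePart z), ← integral_const_mul]
    refine integral_congr_ae (ae_of_all _ fun t => ?_)
    simp only [chi_add_right, timePart_sub, add_sub_cancel_right]
    rw [show t + timePart z - timePart w = t - (timePart w - timePart z) by abel]
    ring
  rw [h3, norm_mul, norm_chi, one_mul]

section

variable {E : Type*} [NormedAddCommGroup E] [InnerProductSpace ℂ E]

lemma continuous_rankOne_self :
    Continuous fun x : E => InnerProductSpace.rankOne ℂ x x := by
  have h : (fun x : E => InnerProductSpace.rankOne ℂ x x) =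
      fun x => ContinuousLinearMap.smulRightL ℂ E E (innerSL ℂ x) x := by
    ext x y; simp
  rw [h]
  exact (ContinuousLinearMap.smulRightL ℂ E E).continuous₂.comp
    ((innerSL ℂ).continuous.prodMk continuous_id)

lemma isCompactOperator_rankOne
    (x y : E) : IsCompactOperator (InnerProductSpace.rankOne ℂ x y) := by
  have h : IsCompactOperator (innerSL ℂ y) := by
    refine ⟨Metric.closedBall 0 1, isCompact_closedBall _ _, ?_⟩
    exact (innerSL ℂ y).continuous.continuousAt.preimage_mem_nhds
      (by simpa using Metric.closedBall_mem_nhds (0 : ℂ) one_pos)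
  exact h.clm_comp (ContinuousLinearMap.toSpanSingleton ℂ x)

/-- The compact operators form a closed, hence complete, subspace, so the integral can be taken
inside it. -/
lemma isCompactOperator_setIntegral {X : Type*} [CompleteSpace E] [TopologicalSpace X]
    [MeasurableSpace X] [OpensMeasurableSpace X] [SecondCountableTopology X] [T2Space X]
    (μ : Measure X) [IsFiniteMeasureOnCompacts μ] {R : X → E →L[ℂ] E} (hc : Continuous R)
    (hR : ∀ x, IsCompactOperator (R x)) {Ω : Set X} (hΩ : IsCompact Ω) :
    IsCompactOperator (∫ x in Ω, R x ∂μ : E →L[ℂ] E) := by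
  let K : Submodule ℂ (E →L[ℂ] E) := compactOperator (RingHom.id ℂ) E E
  have hKc : IsClosed (K : Set (E →L[ℂ] E)) := isClosed_setOfPred_isCompactOperator
  have : CompleteSpace K := hKc.completeSpace_coe
  let S : X → K := fun z => ⟨R z, hR z⟩
  have hS : Continuous S := hc.subtype_mk _
  have h := (K.subtypeL).integral_comp_comm (hS.continuousOn.integrableOn_compact (μ := μ) hΩ)
  have : ∫ x in Ω, R x ∂μ = K.subtypeL (∫ z in Ω, S z ∂μ) := by rw [← h]; rfl
  rw [this]
  exact (∫ z in Ω, S z ∂μ).2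

end

/-- The time-frequency localization operator as a bounded operator on `L²`. -/
def locOp (g : L2 d) (Ω : Set (Phase d)) : L2 d →L[ℂ] L2 d :=
  ∫ z in Ω, InnerProductSpace.rankOne ℂ (atom g z) (atom g z)

lemma continuous_rankOne_atom (g : L2 d) :
    Continuous fun z => InnerProductSpace.rankOne ℂ (atom g z) (atom g z) :=
  continuous_rankOne_self.comp (continuous_atom g)

variable {Ω : Set (Phase d)}

lemma locOp_apply (g : L2 d) (hΩ : IsCompact Ω) (f : L2 d) :
    locOp g Ω f = ∫ z in Ω, stft g f z • atom g z := by
  rw [locOp, ContinuousLinearMap.integral_apply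
    ((continuous_rankOne_atom g).continuousOn.integrableOn_compact hΩ)]
  simp [stft_eq_inner]

lemma inner_locOp (g : L2 d) (hΩ : IsCompact Ω) (u f : L2 d) :
    inner ℂ u (locOp g Ω f) = ∫ z in Ω, stft g f z * inner ℂ u (atom g z) := by
  rw [locOp_apply g hΩ, ← integral_inner]
  · simp [inner_smul_right]
  · exact (((continuous_stft g f).smul (continuous_atom g)).continuousOn).integrableOn_compact hΩ

lemma inner_locOp_self (g : L2 d) (hΩ : IsCompact Ω) (f : L2 d) :
    inner ℂ f (locOp g Ω f) = ((∫ z in Ω, ‖stft g f z‖ ^ 2 : ℝ) : ℂ) := by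
  rw [inner_locOp g hΩ, ← integral_complex_ofReal]
  congr 1; ext z
  rw [← inner_conj_symm f, ← stft_eq_inner, Complex.mul_conj, Complex.normSq_eq_norm_sq]

lemma isSymmetric_locOp (g : L2 d) (hΩ : IsCompact Ω) :
    (locOp g Ω : L2 d →ₗ[ℂ] L2 d).IsSymmetric := by
  intro u f
  simp only [ContinuousLinearMap.coe_coe]
  rw [← inner_conj_symm, inner_locOp g hΩ, inner_locOp g hΩ, ← integral_conj]
  congr 1; ext z
  rw [map_mul, inner_conj_symm, ← stft_eq_inner, mul_comm, stft_eq_inner g u, inner_conj_symm]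

lemma isCompactOperator_locOp (g : L2 d) (hΩ : IsCompact Ω) : IsCompactOperator (locOp g Ω) :=
  isCompactOperator_setIntegral volume (continuous_rankOne_atom g)
    (fun _ => isCompactOperator_rankOne _ _) hΩ

/-- Justifies Fubini when the pointwise integral `locFun` is tested against a set `E` of finite
measure. -/
lemma integrable_prod_atom (g f : L2 d) (hΩ : IsCompact Ω) {E : Set (Sp d)}
    (hE' : volume E < ∞) :
    Integrable (fun p : Phase d × Sp d => stft g f p.1 * g (p.2 - timePart p.1) *
      chi (freqPart p.1) p.2) ((volume.restrict Ω).prod (volume.restrict E)) := by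
  have : IsFiniteMeasure (volume.restrict Ω) := ⟨by simpa using hΩ.measure_lt_top⟩
  have : IsFiniteMeasure (volume.restrict E) := ⟨by simpa using hE'⟩
  have hmeas : AEStronglyMeasurable (fun p : Phase d × Sp d => stft g f p.1 *
      g (p.2 - timePart p.1) * chi (freqPart p.1) p.2)
      ((volume.restrict Ω).prod (volume.restrict E)) := by
    refine ((((continuous_stft g f).comp continuous_fst).aestronglyMeasurable).mul ?_).mul ?_
    · exact ((Lp.stronglyMeasurable g).comp_measurable
        (measurable_snd.sub (continuous_timePart.measurable.comp measurable_fst))).aestronglyMeasurable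
    · exact (continuous_chi.comp ((continuous_freqPart.comp continuous_fst).prodMk
        continuous_snd)).aestronglyMeasurable
  have hg : ∀ z : Phase d, Integrable (atom g z) (volume.restrict E) := fun z =>
    ((Lp.memLp (atom g z)).restrict E).integrable (by norm_num)
  have hz : ∀ z : Phase d, (fun t => stft g f z * g (t - timePart z) * chi (freqPart z) t)
      =ᵐ[volume.restrict E] fun t => stft g f z * atom g z t := fun z => by
    filter_upwards [ae_restrict_of_ae (atom_ae g z)] with t ht
    rw [ht]; ring
  rw [integrable_prod_iff hmeas]
  refine ⟨ae_of_all _ fun z => ((hg z).const_mul (stft g f z)).congr (hz z).symm, ?_⟩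
  refine Integrable.of_bound hmeas.norm.integral_prod_right'
    (‖g‖ * ‖f‖ * (‖g‖ ^ 2 + volume.real E)) (ae_of_all _ fun z => ?_)
  have h2 : Integrable (fun t => ‖atom g z t‖ ^ 2) volume :=
    (memLp_two_iff_integrable_sq_norm (Lp.aestronglyMeasurable _)).1 (Lp.memLp (atom g z))
  have h3 : ∫ t, ‖atom g z t‖ ^ 2 = ‖g‖ ^ 2 := by
    rw [← norm_atom g z, ← @inner_self_eq_norm_sq ℂ, L2.inner_def]
    rw [← integral_re (L2.integrable_inner _ _)]
    simp [← inner_self_eq_norm_sq (𝕜 := ℂ)]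
  rw [Real.norm_of_nonneg (integral_nonneg fun _ => norm_nonneg _)]
  calc ∫ t in E, ‖stft g f z * g (t - timePart z) * chi (freqPart z) t‖
      = ‖stft g f z‖ * ∫ t in E, ‖atom g z t‖ := by
        rw [← integral_const_mul]
        refine integral_congr_ae ?_
        filter_upwards [hz z] with t ht
        rw [ht, norm_mul]
    _ ≤ ‖g‖ * ‖f‖ * (‖g‖ ^ 2 + volume.real E) := by
        refine mul_le_mul (norm_stft_le g f z) ?_ (integral_nonneg fun _ => norm_nonneg _)
          (by positivity)
        -- The elementary bound `a ≤ a² + 1` replaces Cauchy–Schwarz.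
        calc ∫ t in E, ‖atom g z t‖ ≤ ∫ t in E, (‖atom g z t‖ ^ 2 + 1) := by
              refine integral_mono (hg z).norm (h2.integrableOn.add (integrable_const _)) fun t => ?_
              simp only
              nlinarith [sq_nonneg (‖atom g z t‖ - 1), sq_nonneg (‖atom g z t‖)]
          _ = (∫ t in E, ‖atom g z t‖ ^ 2) + volume.real E := by
              rw [integral_add h2.integrableOn (integrable_const _)]; simp [Measure.real]
          _ ≤ _ := by
              gcongr
              rw [← h3]
              exact setIntegral_le_integral h2 (ae_of_all _ fun _ => by positivity)

lemma locFun_eq (g f : L2 d) (t : Sp d) :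
    locFun g Ω f t = ∫ z in Ω, stft g f z * g (t - timePart z) * chi (freqPart z) t := rfl

/-- Links the operator-valued integral to the pointwise formula: both have the same integral over
every set of finite measure. -/
lemma locOp_ae_eq (g : L2 d) (hΩ : IsCompact Ω) (f : L2 d) :
    locOp g Ω f =ᵐ[volume] locFun g Ω f := by
  refine ae_eq_of_forall_setIntegral_eq_of_sigmaFinite (fun E hE hE' => ?_) (fun E hE hE' => ?_)
    (fun E hE hE' => ?_)
  · have : IsFiniteMeasure (volume.restrict E) := ⟨by simpa using hE'⟩
    exact ((Lp.memLp (locOp g Ω f)).restrict E).integrable (by norm_num)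
  · exact (integrable_prod_atom g f hΩ hE').integral_prod_right
  · have h1 : ∀ u : L2 d, ∫ t in E, u t =
        inner ℂ (indicatorConstLp 2 hE hE'.ne (1 : ℂ)) u := fun u =>
      (L2.inner_indicatorConstLp_one hE hE'.ne u).symm
    rw [h1, inner_locOp g hΩ]
    simp_rw [← h1, locFun_eq]
    rw [← integral_integral_swap (integrable_prod_atom g f hΩ hE')]
    refine integral_congr_ae (ae_of_all _ fun z => ?_)
    simp only
    rw [← integral_const_mul]
    refine integral_congr_ae ?_
    filter_upwards [ae_restrict_of_ae (atom_ae g z)] with t ht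
    rw [ht]; ring

end

/-! ### Plancherel's theorem and Moyal's identity. -/

section

open Filter Topology FourierTransform
open scoped SchwartzMap

variable {d : ℕ}

section Plancherel

variable {V : Type*} [NormedAddCommGroup V] [InnerProductSpace ℝ V] [FiniteDimensional ℝ V]
  [MeasurableSpace V] [BorelSpace V]

/-- The multiplication formula, which moves the Fourier transform from the test function to `f`. -/
lemma integral_fourier_smul_toLp {f : V → ℂ} (h1 : Integrable f) (h2 : MemLp f 2) (ψ : 𝓢(V, ℂ)) :
    ∫ x, (𝓕 ψ) x • (h2.toLp f) x = ∫ x, ψ x • 𝓕 f x := by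
  have e2 : ∫ ξ, 𝓕 (ψ : V → ℂ) ξ • f ξ = ∫ x, ψ x • 𝓕 f x := by
    have h := VectorFourier.integral_fourierIntegral_smul_eq_flip (L := innerₗ V)
      Real.continuous_fourierChar continuous_inner (ψ.integrable (μ := volume)) h1
    rw [flip_innerₗ] at h
    exact h
  rw [← e2]
  refine integral_congr_ae ?_
  filter_upwards [h2.coeFn_toLp] with x hx
  rw [hx, SchwartzMap.fourier_coe]

/-- The Fourier integral of a function in `L¹ ∩ L²` represents its `L²` Fourier transform. -/
lemma fourier_toLp_ae_eq {f : V → ℂ} (h1 : Integrable f) (h2 : MemLp f 2) :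
    (𝓕 (h2.toLp f) : Lp ℂ 2 (volume : Measure V)) =ᵐ[volume] 𝓕 f := by
  have hcont : Continuous (𝓕 f) := VectorFourier.fourierIntegral_continuous
    Real.continuous_fourierChar (L := innerₗ V) continuous_inner h1
  refine ae_eq_of_integral_contDiff_smul_eq ((Lp.memLp _).locallyIntegrable (by norm_num))
    hcont.locallyIntegrable fun φ hφ hφc => ?_
  have hφ' : ContDiff ℝ ((⊤ : ℕ∞) : WithTop ℕ∞) fun x => (φ x : ℂ) :=
    Complex.ofRealCLM.contDiff.comp hφ
  have hφc' : HasCompactSupport fun x => (φ x : ℂ) := hφc.comp_left (g := Complex.ofReal) (by simp)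
  let ψ : 𝓢(V, ℂ) := hφc'.toSchwartzMap hφ'
  have hψ : ∀ x, ψ x = (φ x : ℂ) := fun x => rfl
  clear_value ψ
  -- The `L²` transform agrees with the distributional one, so both sides can be compared on test
  -- functions.
  have e1 := congrArg (fun T => T ψ) (Lp.fourier_toTemperedDistribution_eq (h2.toLp f))
  simp only [TemperedDistribution.fourier_apply, Lp.toTemperedDistribution_apply] at e1
  rw [integral_fourier_smul_toLp h1 h2] at e1
  simp only [hψ] at e1
  exact e1.symm

lemma enorm_sq_toLp {f : V → ℂ} (h2 : MemLp f 2) :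
    ‖h2.toLp f‖ₑ ^ 2 = ∫⁻ x, ‖f x‖ₑ ^ 2 := by
  rw [Lp.enorm_toLp, eLpNorm_eq_lintegral_rpow_enorm_toReal (by norm_num) (by norm_num)]
  simp only [ENNReal.toReal_ofNat, ENNReal.rpow_ofNat, one_div]
  rw [← ENNReal.rpow_natCast, ← ENNReal.rpow_mul]
  norm_num

lemma enorm_sq_eq_lintegral (f : Lp ℂ 2 (volume : Measure V)) :
    ‖f‖ₑ ^ 2 = ∫⁻ x, ‖f x‖ₑ ^ 2 := by
  rw [← enorm_sq_toLp (Lp.memLp f), Lp.toLp_coeFn]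

/-- **Plancherel's theorem** for the Fourier integral on `L¹ ∩ L²`. -/
lemma lintegral_enorm_sq_fourier {f : V → ℂ} (h1 : Integrable f) (h2 : MemLp f 2) :
    ∫⁻ ξ, ‖𝓕 f ξ‖ₑ ^ 2 = ∫⁻ x, ‖f x‖ₑ ^ 2 := by
  rw [← enorm_sq_toLp h2, ← (Lp.fourierTransformₗᵢ V ℂ).enorm_map, enorm_sq_eq_lintegral]
  refine lintegral_congr_ae ?_
  filter_upwards [fourier_toLp_ae_eq h1 h2] with x hx
  rw [← hx]; rfl

end Plancherel

/-- The point of the time-frequency plane with given components. -/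
def ofParts (p : Sp d × Sp d) : Phase d := WithLp.toLp 2 (Sum.elim p.1 p.2)

lemma continuous_ofParts : Continuous (ofParts : Sp d × Sp d → Phase d) := by
  refine (PiLp.continuous_toLp 2 _).comp (continuous_pi fun i => ?_)
  cases i <;> simp only [Sum.elim_inl, Sum.elim_inr] <;> fun_prop

lemma ofParts_parts (z : Phase d) : ofParts (timePart z, freqPart z) = z := by
  ext i; cases i <;> rfl

lemma measurePreserving_parts :
    MeasurePreserving (fun z : Phase d => (timePart z, freqPart z)) volume volume := by
  have h1 := PiLp.volume_preserving_ofLp (Fin d ⊕ Fin d)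
  have h2 := volume_measurePreserving_sumPiEquivProdPi (fun _ : Fin d ⊕ Fin d => ℝ)
  have h3 := (PiLp.volume_preserving_toLp (Fin d)).prod (PiLp.volume_preserving_toLp (Fin d))
  exact h3.comp (h2.comp h1)

lemma stft_eq_fourier (g f : L2 d) (z : Phase d) :
    stft g f z = 𝓕 (fun t => f t * conj (g (t - timePart z))) (freqPart z) := by
  rw [stft, Real.fourier_eq']
  refine integral_congr_ae (ae_of_all _ fun t => ?_)
  simp only [smul_eq_mul]
  rw [mul_comm]
  congr 2
  rw [real_inner_comm]; push_cast; ring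

/-- **Moyal's identity.** -/
lemma lintegral_enorm_sq_stft (g f : L2 d) :
    ∫⁻ z, ‖stft g f z‖ₑ ^ 2 = ‖f‖ₑ ^ 2 * ‖g‖ₑ ^ 2 := by
  have hG : Measurable fun p : Sp d × Sp d => ‖stft g f (ofParts p)‖ₑ ^ 2 :=
    ((continuous_stft g f).comp continuous_ofParts).measurable.enorm.pow_const 2
  have hf := (Lp.stronglyMeasurable f).measurable
  have hg := (Lp.stronglyMeasurable g).measurable
  have hFm : Measurable fun p : Sp d × Sp d => f p.2 * conj (g (p.2 - p.1)) :=
    (hf.comp measurable_snd).mul (Complex.continuous_conj.measurable.comp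
      (hg.comp (measurable_snd.sub measurable_fst)))
  have hT : ∫⁻ x : Sp d, ∫⁻ t : Sp d, ‖f t * conj (g (t - x))‖ₑ ^ 2 = ‖f‖ₑ ^ 2 * ‖g‖ₑ ^ 2 := by
    rw [lintegral_lintegral_swap (hFm.enorm.pow_const 2).aemeasurable, enorm_sq_eq_lintegral f,
      ← lintegral_mul_const _ (hf.enorm.pow_const 2)]
    refine lintegral_congr fun t => ?_
    have hc : ∀ x : Sp d, ‖conj (g (t - x))‖ₑ = ‖g (t - x)‖ₑ := fun x => by
      rw [← ofReal_norm, ← ofReal_norm, RCLike.norm_conj]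
    simp_rw [enorm_mul, mul_pow, hc]
    have hgm : Measurable fun x : Sp d => ‖g (t - x)‖ₑ ^ 2 :=
      (hg.comp (measurable_const.sub measurable_id)).enorm.pow_const 2
    rw [lintegral_const_mul _ hgm, enorm_sq_eq_lintegral g,
      lintegral_sub_left_eq_self (fun x => ‖g x‖ₑ ^ 2) t]
  -- For fixed `x`, `V_g f(x, ·)` is the Fourier transform of `t ↦ f(t) conj(g(t - x))`. This
  -- product is always in `L¹`, but in `L²` only for almost every `x`, which suffices for Plancherel
  -- in `ξ`.
  have hfin : ∀ᵐ x : Sp d, ∫⁻ t : Sp d, ‖f t * conj (g (t - x))‖ₑ ^ 2 < ∞ := by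
    refine ae_lt_top (hFm.enorm.pow_const 2).lintegral_prod_right' ?_
    rw [hT]
    exact ENNReal.mul_ne_top (by simp) (by simp)
  calc ∫⁻ z, ‖stft g f z‖ₑ ^ 2
      = ∫⁻ z : Phase d, ‖stft g f (ofParts (timePart z, freqPart z))‖ₑ ^ 2 := by
        simp_rw [ofParts_parts]
    _ = ∫⁻ p : Sp d × Sp d, ‖stft g f (ofParts p)‖ₑ ^ 2 :=
        measurePreserving_parts.lintegral_comp hG
    _ = ∫⁻ x : Sp d, ∫⁻ ξ : Sp d, ‖stft g f (ofParts (x, ξ))‖ₑ ^ 2 :=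
        lintegral_prod _ hG.aemeasurable
    _ = ∫⁻ x : Sp d, ∫⁻ t : Sp d, ‖f t * conj (g (t - x))‖ₑ ^ 2 := by
        refine lintegral_congr_ae ?_
        filter_upwards [hfin] with x hx
        have hm : Measurable fun t => f t * conj (g (t - x)) :=
          hFm.comp (measurable_const.prodMk measurable_id)
        have h2 : MemLp (fun t => f t * conj (g (t - x))) 2 volume := by
          refine ⟨hm.aestronglyMeasurable, ?_⟩
          rw [eLpNorm_lt_top_iff_lintegral_rpow_enorm_lt_top (by norm_num) (by norm_num)]
          simpa using hx
        have h1 : Integrable (fun t => f t * conj (g (t - x))) volume := by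
          have hgx : MemLp (fun t => conj (g (t - x))) 2 volume :=
            ((Lp.memLp g).comp_measurePreserving (measurePreserving_sub_right volume x)).star
          exact (Lp.memLp f).integrable_mul hgx
        rw [← lintegral_enorm_sq_fourier h1 h2]
        refine lintegral_congr fun ξ => ?_
        rw [stft_eq_fourier]
        rfl
    _ = _ := hT

end

/-! ### Perimeter and translations of a set. -/

section

open Filter Topology

section Perimeter

variable {ι : Type*} [Fintype ι]

lemma exists_contDiff_cutoff {K U : Set (EuclideanSpace ℝ ι)} (hK : IsCompact K) (hU : IsOpen U)
    (hKU : K ⊆ U) : ∃ ψ : EuclideanSpace ℝ ι → ℝ, ContDiff ℝ 1 ψ ∧ HasCompactSupport ψ ∧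
      (∀ x, 0 ≤ ψ x) ∧ (∀ x, ψ x ≤ 1) ∧ (∀ x ∈ K, ψ x = 1) ∧ ∀ x, x ∉ U → ψ x = 0 := by
  -- The cutoff will vanish off `W`, whose compact closure provides the compact support.
  obtain ⟨W, hW, hKW, hWU, hWc⟩ := exists_open_between_and_isCompact_closure hK hU hKU
  obtain ⟨f, hf, hr, h0, h1⟩ := exists_contMDiff_zero_iff_one_iff_of_isClosed
    (n := 1) (modelWithCornersSelf ℝ (EuclideanSpace ℝ ι)) hW.isClosed_compl hK.isClosed
    (Set.disjoint_left.2 fun x hx hx' => hx (hKW hx'))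
  have hr' : ∀ x, f x ∈ Set.Icc (0 : ℝ) 1 := fun x => hr ⟨x, rfl⟩
  refine ⟨f, hf.contDiff, ?_, fun x => (hr' x).1, fun x => (hr' x).2, fun x hx => (h1 x).1 hx,
    fun x hx => (h0 x).1 fun hxW => hx (hWU (subset_closure hxW))⟩
  refine HasCompactSupport.intro hWc fun x hx => (h0 x).1 fun hxW => hx (subset_closure hxW)

variable [DecidableEq ι]

/-- Fields of constant direction turn the perimeter into a bound on directional derivatives. -/
lemma divergence_smul_const {ψ : EuclideanSpace ℝ ι → ℝ} (hψ : Differentiable ℝ ψ)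
    (c x : EuclideanSpace ℝ ι) : divergence (fun y => ψ y • c) x = fderiv ℝ ψ x c := by
  have h : ∀ y, fderiv ℝ (fun y => ψ y • c) x y = fderiv ℝ ψ x y • c := fun y => by
    rw [fderiv_smul_const (hψ x)]; rfl
  simp only [divergence, h]
  conv_rhs => rw [← (EuclideanSpace.basisFun ι ℝ).sum_repr c, map_sum]
  refine Finset.sum_congr rfl fun i _ => ?_
  simp [mul_comm]

lemma integral_divergence_le {Ω : Set (EuclideanSpace ℝ ι)} (hΩ : MeasurableSet Ω)
    (hP : perimeter Ω < ∞) {φ : EuclideanSpace ℝ ι → EuclideanSpace ℝ ι} (h1 : ContDiff ℝ 1 φ)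
    (h2 : HasCompactSupport φ) (h3 : ∀ x, ‖φ x‖ ≤ 1) :
    ∫ x in Ω, divergence φ x ≤ (perimeter Ω).toReal := by
  have h : ENNReal.ofReal (∫ x, Ω.indicator (fun _ => (1 : ℝ)) x * divergence φ x) ≤ perimeter Ω :=
    le_iSup₂_of_le (f := fun (φ : EuclideanSpace ℝ ι → EuclideanSpace ℝ ι) (_ : φ ∈ {φ |
      ContDiff ℝ 1 φ ∧ HasCompactSupport φ ∧ ∀ x, ‖φ x‖ ≤ 1}) =>
        ENNReal.ofReal (∫ x, Ω.indicator (fun _ => (1 : ℝ)) x * divergence φ x))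
      φ ⟨h1, h2, h3⟩ le_rfl
  rw [ENNReal.ofReal_le_iff_le_toReal hP.ne] at h
  rw [← integral_indicator hΩ]
  refine le_of_eq_of_le (integral_congr_ae (ae_of_all _ fun x => ?_)) h
  by_cases hx : x ∈ Ω <;> simp [hx]

/-- The difference quotients of a characteristic function are controlled by the perimeter. -/
lemma setIntegral_sub_translate_le {Ω : Set (EuclideanSpace ℝ ι)} (hΩ : IsCompact Ω)
    (hP : perimeter Ω < ∞) {ψ : EuclideanSpace ℝ ι → ℝ} (h1 : ContDiff ℝ 1 ψ)
    (h2 : HasCompactSupport ψ) (h3 : ∀ x, |ψ x| ≤ 1) (v : EuclideanSpace ℝ ι) :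
    ∫ x in Ω, (ψ (x + v) - ψ x) ≤ ‖v‖ * (perimeter Ω).toReal := by
  rcases eq_or_ne v 0 with rfl | hv
  · simp
  have hv' : 0 < ‖v‖ := norm_pos_iff.2 hv
  have hd : Differentiable ℝ ψ := h1.differentiable (by norm_num)
  have hcont : Continuous fun p : EuclideanSpace ℝ ι × ℝ => fderiv ℝ ψ (p.1 + p.2 • v) v :=
    ((h1.continuous_fderiv (by norm_num)).comp
      (by fun_prop : Continuous fun p : EuclideanSpace ℝ ι × ℝ => p.1 + p.2 • v)).clm_apply
      continuous_const
  have hftc : ∀ x, ψ (x + v) - ψ x = ∫ s in (0 : ℝ)..1, fderiv ℝ ψ (x + s • v) v := by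
    intro x
    have hderiv : ∀ s ∈ Set.uIcc (0 : ℝ) 1,
        HasDerivAt (fun s : ℝ => ψ (x + s • v)) (fderiv ℝ ψ (x + s • v) v) s := by
      intro s _
      have hl : HasDerivAt (fun s : ℝ => x + s • v) v s := by
        simpa using ((hasDerivAt_id s).smul_const v).const_add x
      exact (hd _).hasFDerivAt.comp_hasDerivAt s hl
    rw [intervalIntegral.integral_eq_sub_of_hasDerivAt hderiv]
    · simp
    · exact (hcont.comp (by fun_prop : Continuous fun s : ℝ => (x, s))).intervalIntegrable _ _
  have hint : Integrable (fun p : EuclideanSpace ℝ ι × ℝ => fderiv ℝ ψ (p.1 + p.2 • v) v)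
      ((volume.restrict Ω).prod (volume.restrict (Set.Ioc (0 : ℝ) 1))) := by
    rw [Measure.prod_restrict]
    exact (hcont.continuousOn.integrableOn_compact (hΩ.prod isCompact_Icc)).mono_set
      (Set.prod_mono le_rfl Set.Ioc_subset_Icc_self)
  -- At each time `s` the integrand is `‖v‖` times the divergence of the admissible field `ψ(· + s
  -- v) v/‖v‖`; integrating over `s` in `[0, 1]` then gives the claim.
  have hs : ∀ s : ℝ, ∫ x in Ω, fderiv ℝ ψ (x + s • v) v ≤ ‖v‖ * (perimeter Ω).toReal := by
    intro s
    let η : EuclideanSpace ℝ ι → ℝ := fun x => ψ (x + s • v)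
    have hη : ContDiff ℝ 1 η := h1.comp (contDiff_id.add contDiff_const)
    have hηc : HasCompactSupport η := h2.comp_homeomorph (Homeomorph.addRight (s • v))
    have hdiv : ∀ x, fderiv ℝ ψ (x + s • v) v =
        ‖v‖ * divergence (fun y => η y • (‖v‖⁻¹ • v)) x := by
      intro x
      rw [divergence_smul_const (hη.differentiable (by norm_num)), map_smul, smul_eq_mul,
        mul_inv_cancel_left₀ hv'.ne', fderiv_comp_add_right]
    simp_rw [hdiv]
    rw [integral_const_mul]
    refine mul_le_mul_of_nonneg_left ?_ hv'.le
    refine integral_divergence_le hΩ.measurableSet hP (hη.smul contDiff_const) hηc.smul_right ?_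
    intro x
    rw [norm_smul, norm_smul, norm_inv, norm_norm, inv_mul_cancel₀ hv'.ne', mul_one]
    exact h3 _
  simp_rw [hftc, intervalIntegral.integral_of_le zero_le_one]
  rw [integral_integral_swap hint]
  calc ∫ s in Set.Ioc (0 : ℝ) 1, ∫ x in Ω, fderiv ℝ ψ (x + s • v) v
      ≤ ∫ s in Set.Ioc (0 : ℝ) 1, ‖v‖ * (perimeter Ω).toReal :=
        integral_mono hint.integral_prod_right (integrable_const _) hs
    _ = _ := by simp

/-- The part of a set that leaves it under a translation has measure at most the length of the
translation times the perimeter. -/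
lemma volume_sdiff_translate_le {Ω : Set (EuclideanSpace ℝ ι)} (hΩ : IsCompact Ω)
    (hP : perimeter Ω < ∞) (v : EuclideanSpace ℝ ι) :
    volume {x | x ∈ Ω ∧ x - v ∉ Ω} ≤ ENNReal.ofReal ‖v‖ * perimeter Ω := by
  set A : Set (EuclideanSpace ℝ ι) := {x | x ∈ Ω ∧ x - v ∉ Ω} with hA
  have hΩm := hΩ.measurableSet
  have hAm : MeasurableSet A :=
    hΩm.inter ((measurable_id.sub_const v) hΩm.compl)
  have hAΩ : A ⊆ Ω := fun x hx => hx.1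
  have hAfin : volume A ≠ ∞ := ((measure_mono hAΩ).trans_lt hΩ.measure_lt_top).ne
  rw [← ENNReal.ofReal_toReal hP.ne, ← ENNReal.ofReal_mul (norm_nonneg v),
    ← ENNReal.ofReal_toReal hAfin]
  refine ENNReal.ofReal_le_ofReal (le_of_forall_pos_le_add fun ε hε => ?_)
  have hε2 : ENNReal.ofReal (ε / 4) ≠ 0 := by simpa using (by positivity : 0 < ε / 4)
  obtain ⟨K, hKA, hK, hKε⟩ := hAm.exists_isCompact_sdiff_lt hAfin hε2
  obtain ⟨U, hAU, hU, hUfin, hUε⟩ := hAm.exists_isOpen_sdiff_lt hAfin hε2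
  obtain ⟨ψ, hψ, hψc, hψ0, hψ1, hψK, hψU⟩ := exists_contDiff_cutoff hK hU (hKA.trans hAU)
  have hψa : ∀ x, |ψ x| ≤ 1 := fun x => abs_le.2 ⟨by linarith [hψ0 x], hψ1 x⟩
  -- `ψ` approximates the indicator of `A`. The sign is chosen because `∫_Ω (ψ(x) - ψ(x + v))`
  -- equals `∫ ψ(x) (1_Ω(x) - 1_Ω(x - v))`, whose last factor is 1 on `A`.
  have hmain := setIntegral_sub_translate_le hΩ hP hψ.neg hψc.neg (by simpa using hψa) v
  have hψi : Integrable ψ := hψ.continuous.integrable_of_hasCompactSupport hψc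
  have hψi' : Integrable fun x => ψ (x + v) := hψi.comp_add_right v
  have hKfin : volume K ≠ ∞ := hK.measure_lt_top.ne
  have hUK : volume (U \ K) ≤ ENNReal.ofReal (ε / 2) := by
    calc volume (U \ K) ≤ volume ((U \ A) ∪ (A \ K)) := measure_mono fun x hx => by
          by_cases h : x ∈ A
          · exact Or.inr ⟨h, hx.2⟩
          · exact Or.inl ⟨hx.1, h⟩
      _ ≤ volume (U \ A) + volume (A \ K) := measure_union_le _ _
      _ ≤ ENNReal.ofReal (ε / 4) + ENNReal.ofReal (ε / 4) := add_le_add hUε.le hKε.le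
      _ = ENNReal.ofReal (ε / 2) := by
          rw [← ENNReal.ofReal_add (by positivity) (by positivity)]; congr 1; ring
  have hUKr : volume.real (U \ K) ≤ ε / 2 := ENNReal.toReal_le_of_le_ofReal (by positivity) hUK
  have hUKm : MeasurableSet (U \ K) := hU.measurableSet.diff hK.measurableSet
  have hAKr : volume.real A ≤ volume.real K + ε / 2 := by
    have : volume.real A ≤ volume.real (K ∪ (U \ K)) := by
      refine measureReal_mono (fun x hx => ?_) ?_
      · by_cases h : x ∈ K
        · exact Or.inl h
        · exact Or.inr ⟨hAU hx, h⟩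
      · exact (measure_union_lt_top hKfin.lt_top (hUK.trans_lt (by simp))).ne
    linarith [measureReal_union_le (μ := volume) K (U \ K)]
  -- The difference of indicators is 1 on `K` and at least -1 on `U \ K`. The set `U \ K` costs `ε /
  -- 2` here and `ε / 2` in `hAKr`.
  have hlow : volume.real K - volume.real (U \ K) ≤ ∫ x in Ω, (ψ x - ψ (x + v)) := by
    have i1 : Integrable fun x => ψ x * Ω.indicator (fun _ => (1 : ℝ)) x := by
      have := hψi.indicator hΩm
      refine this.congr (ae_of_all _ fun x => ?_)
      by_cases hx : x ∈ Ω <;> simp [hx]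
    have i2 : Integrable fun x => ψ (x + v) * Ω.indicator (fun _ => (1 : ℝ)) x := by
      have := hψi'.indicator hΩm
      refine this.congr (ae_of_all _ fun x => ?_)
      by_cases hx : x ∈ Ω <;> simp [hx]
    have i3 : Integrable fun x => ψ x * Ω.indicator (fun _ => (1 : ℝ)) (x - v) := by
      simpa using i2.comp_sub_right v
    have e1 : ∫ x in Ω, (ψ x - ψ (x + v)) =
        ∫ x, ψ x * (Ω.indicator (fun _ => (1 : ℝ)) x - Ω.indicator (fun _ => (1 : ℝ)) (x - v)) := by
      have e3 : ∫ x, ψ x * Ω.indicator (fun _ => (1 : ℝ)) (x - v) =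
          ∫ x, ψ (x + v) * Ω.indicator (fun _ => (1 : ℝ)) x := by
        rw [← integral_add_right_eq_self _ v]; simp
      simp_rw [mul_sub]
      rw [integral_sub i1 i3, e3, ← integral_sub i1 i2, ← integral_indicator hΩm]
      congr 1; ext x
      by_cases hx : x ∈ Ω <;> simp [hx]
    rw [e1]
    have i4 : Integrable (K.indicator fun _ => (1 : ℝ)) :=
      (integrable_indicator_iff hK.measurableSet).2 (integrableOn_const hKfin)
    have i5 : Integrable ((U \ K).indicator fun _ => (1 : ℝ)) :=
      (integrable_indicator_iff hUKm).2 (integrableOn_const (hUK.trans_lt (by simp)).ne)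
    have e2 : volume.real K - volume.real (U \ K) =
        ∫ x, (K.indicator (fun _ => (1 : ℝ)) x - (U \ K).indicator (fun _ => (1 : ℝ)) x) := by
      rw [integral_sub i4 i5]
      simp [integral_indicator_const, hK.measurableSet, hUKm]
    rw [e2]
    refine integral_mono (i4.sub i5) ((i1.sub i3).congr (ae_of_all _ fun x => ?_)) fun x => ?_
    · simp only [Pi.sub_apply]; ring
    have b0 := hψ0 x
    have b1 := hψ1 x
    by_cases hxK : x ∈ K
    · have h1 : x ∈ Ω := (hKA hxK).1
      have h2 : x - v ∉ Ω := (hKA hxK).2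
      simp [hxK, h1, h2, hψK x hxK]
    · by_cases hxU : x ∈ U
      · by_cases h1 : x ∈ Ω <;> by_cases h2 : x - v ∈ Ω <;> simp [hxK, hxU, h1, h2] <;> linarith
      · simp [hxK, hxU, hψU x hxU]
  have : ∫ x in Ω, (-ψ (x + v) - -ψ x) = ∫ x in Ω, (ψ x - ψ (x + v)) := by
    congr 1; ext x; ring
  have h5 : (volume A).toReal = volume.real A := rfl
  rw [h5]
  linarith

/-- The interaction of a set with its complement under a kernel is bounded by the perimeter times
the first moment of the kernel. -/
lemma lintegral_compl_lintegral_le {Ω : Set (EuclideanSpace ℝ ι)} (hΩ : IsCompact Ω)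
    (hP : perimeter Ω < ∞) {Φ : EuclideanSpace ℝ ι → ℝ≥0∞} (hΦ : Measurable Φ) :
    ∫⁻ z in Ωᶜ, ∫⁻ w in Ω, Φ (w - z) ≤ (∫⁻ v, ENNReal.ofReal ‖v‖ * Φ v) * perimeter Ω := by
  have hΩm := hΩ.measurableSet
  have hm1 : Measurable fun p : EuclideanSpace ℝ ι × EuclideanSpace ℝ ι => Φ (p.2 - p.1) :=
    hΦ.comp (measurable_snd.sub measurable_fst)
  have hm2 : Measurable fun p : EuclideanSpace ℝ ι × EuclideanSpace ℝ ι =>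
      Ωᶜ.indicator (fun _ => (1 : ℝ≥0∞)) (p.1 - p.2) * Φ p.2 :=
    ((measurable_const.indicator hΩm.compl).comp (measurable_fst.sub measurable_snd)).mul
      (hΦ.comp measurable_snd)
  calc ∫⁻ z in Ωᶜ, ∫⁻ w in Ω, Φ (w - z)
      = ∫⁻ w in Ω, ∫⁻ z in Ωᶜ, Φ (w - z) := lintegral_lintegral_swap hm1.aemeasurable
    _ = ∫⁻ w in Ω, ∫⁻ v, Ωᶜ.indicator (fun _ => (1 : ℝ≥0∞)) (w - v) * Φ v := by
        refine lintegral_congr fun w => ?_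
        -- Substitution `z = w - v`: for fixed `v`, the points `w` that count are those of `Ω` with
        -- `w - v` outside `Ω`.
        rw [← lintegral_indicator hΩm.compl, ← lintegral_sub_left_eq_self _ w]
        refine lintegral_congr fun v => ?_
        by_cases h : w - v ∈ Ω <;> simp [h]
    _ = ∫⁻ v, ∫⁻ w in Ω, Ωᶜ.indicator (fun _ => (1 : ℝ≥0∞)) (w - v) * Φ v :=
        lintegral_lintegral_swap hm2.aemeasurable
    _ = ∫⁻ v, volume {x | x ∈ Ω ∧ x - v ∉ Ω} * Φ v := by
        refine lintegral_congr fun v => ?_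
        have hm3 : Measurable fun w : EuclideanSpace ℝ ι =>
            Ωᶜ.indicator (fun _ => (1 : ℝ≥0∞)) (w - v) :=
          (measurable_const.indicator hΩm.compl).comp (measurable_id.sub_const v)
        have hA : MeasurableSet {x | x ∈ Ω ∧ x - v ∉ Ω} :=
          hΩm.inter ((measurable_id.sub_const v) hΩm.compl)
        rw [lintegral_mul_const _ hm3, ← lintegral_indicator hΩm, ← lintegral_indicator_one hA]
        congr 2; ext w
        by_cases h1 : w ∈ Ω <;> by_cases h2 : w - v ∈ Ω <;> simp [h1, h2]
    _ ≤ ∫⁻ v, ENNReal.ofReal ‖v‖ * Φ v * perimeter Ω := by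
        refine lintegral_mono fun v => ?_
        calc _ ≤ ENNReal.ofReal ‖v‖ * perimeter Ω * Φ v := by
              gcongr; exact volume_sdiff_translate_le hΩ hP v
          _ = _ := by ring
    _ = _ := lintegral_mul_const _ ((ENNReal.measurable_ofReal.comp measurable_norm).mul hΦ)

end Perimeter

end

/-! ### Eigenvalue estimates and the `L¹` error of the accumulated spectrogram. -/

section

open Filter Topology

variable {d : ℕ} {g : L2 d} {Ω : Set (Phase d)} {lam : ℕ → ℝ} {h : ℕ → L2 d}

/-- If `lam` is non-increasing with values in `[0, 1]` and its sum is at most `N`, then the tail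
from `N` on is bounded by `∑ lam k (1 - lam k)`. -/
lemma tail_le_of_hasSum {a S : ℝ} (hanti : Antitone lam) (h0 : ∀ k, 0 ≤ lam k)
    (h1 : ∀ k, lam k ≤ 1) (ha : HasSum lam a) (hS : HasSum (fun k => lam k * (1 - lam k)) S)
    {N : ℕ} (hN : a ≤ N) : a - ∑ k ∈ Finset.range N, lam k ≤ S := by
  have hfin : HasSum (fun k => if k ∈ Finset.range N then lam N - lam k else 0)
      (∑ k ∈ Finset.range N, (lam N - lam k)) := by
    have := hasSum_sum_of_ne_finset_zero (L := SummationFilter.unconditional ℕ)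
      (f := fun k => if k ∈ Finset.range N then lam N - lam k else 0) (s := Finset.range N)
      (fun b hb => by simp only [if_neg hb])
    rwa [Finset.sum_congr rfl (fun k hk => if_pos hk)] at this
  -- The comparison series has terms `(1 - λ_N) λ_k` for `k ≥ N` and `λ_N (1 - λ_k)` for `k < N`,
  -- both at most `λ_k (1 - λ_k)` by monotonicity. Its sum is `a - ∑_{k<N} λ_k + λ_N (N - a)`, and
  -- the last term is nonnegative.
  have hb := (ha.mul_left (1 - lam N)).add hfin
  have hle := hasSum_le (fun k => ?_) hb hS
  · rw [Finset.sum_sub_distrib, Finset.sum_const, Finset.card_range, nsmul_eq_mul] at hle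
    nlinarith [h0 N, mul_le_mul_of_nonneg_left hN (h0 N)]
  · by_cases hk : k < N
    · have := hanti hk.le
      simp only [Finset.mem_range, hk, if_true]
      nlinarith [h1 k]
    · have := hanti (not_lt.1 hk)
      simp only [Finset.mem_range, hk, if_false]
      nlinarith [h0 k]

namespace IsEigensystem

lemma hasSum_locOp (es : IsEigensystem g Ω lam h) (hΩ : IsCompact Ω) (f : L2 d) :
    HasSum (fun k : ℕ => ((lam k : ℂ) * inner ℂ (h k) f) • h k) (locOp g Ω f) := by
  obtain ⟨F, hF, hs⟩ := es.diagonal f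
  rwa [Lp.ext (hF.trans (locOp_ae_eq g hΩ f).symm)] at hs

lemma hasSum_sq (es : IsEigensystem g Ω lam h) (hΩ : IsCompact Ω) (f : L2 d) :
    HasSum (fun k => lam k * ‖(inner ℂ (h k) f : ℂ)‖ ^ 2) (∫ z in Ω, ‖stft g f z‖ ^ 2) := by
  have h1 := (es.hasSum_locOp hΩ f).mapL (innerSL ℂ f)
  simp only [innerSL_apply_apply, inner_smul_right] at h1
  rw [inner_locOp_self g hΩ] at h1
  rw [← Complex.hasSum_ofReal]
  refine h1.congr_fun fun k => ?_
  rw [mul_assoc, ← inner_conj_symm f, Complex.mul_conj, Complex.normSq_eq_norm_sq]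
  push_cast; ring

lemma setLIntegral_stft (g f : L2 d) (hΩ : IsCompact Ω) :
    ∫⁻ z in Ω, ‖stft g f z‖ₑ ^ 2 = ENNReal.ofReal (∫ z in Ω, ‖stft g f z‖ ^ 2) := by
  have hi : IntegrableOn (fun z => ‖stft g f z‖ ^ 2) Ω :=
    ((continuous_stft g f).norm.pow 2).continuousOn.integrableOn_compact hΩ
  rw [ofReal_integral_eq_lintegral_ofReal hi (ae_of_all _ fun _ => by positivity)]
  refine lintegral_congr fun z => ?_
  rw [ENNReal.ofReal_pow (norm_nonneg _), ofReal_norm]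

lemma tsum_eq (es : IsEigensystem g Ω lam h) (hΩ : IsCompact Ω) (f : L2 d) :
    ∑' k, ENNReal.ofReal (lam k) * ‖(inner ℂ (h k) f : ℂ)‖ₑ ^ 2 =
      ∫⁻ z in Ω, ‖stft g f z‖ₑ ^ 2 := by
  have hs := es.hasSum_sq hΩ f
  rw [setLIntegral_stft g f hΩ, ← hs.tsum_eq,
    ENNReal.ofReal_tsum_of_nonneg (fun k => mul_nonneg (es.nonneg k) (by positivity)) hs.summable]
  congr 1; ext k
  rw [ENNReal.ofReal_mul (es.nonneg k), ENNReal.ofReal_pow (norm_nonneg _), ofReal_norm]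

/-- The quadratic form of the operator at `atom g z`, computed once in the eigensystem and once from
its definition. -/
lemma tsum_stft (es : IsEigensystem g Ω lam h) (hΩ : IsCompact Ω) (z : Phase d) :
    ∑' k, ENNReal.ofReal (lam k) * ‖stft g (h k) z‖ₑ ^ 2 =
      ∫⁻ w in Ω, ‖stft g g (w - z)‖ₑ ^ 2 := by
  have h1 := es.tsum_eq hΩ (atom g z)
  simp_rw [stft_eq_inner g (atom g z)] at h1
  have e1 : ∀ w, ‖(inner ℂ (atom g w) (atom g z) : ℂ)‖ₑ = ‖stft g g (w - z)‖ₑ := fun w => by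
    rw [← ofReal_norm, norm_inner_atom_atom, ofReal_norm]
  have e2 : ∀ k, ‖(inner ℂ (h k) (atom g z) : ℂ)‖ₑ = ‖stft g (h k) z‖ₑ := fun k => by
    rw [← ofReal_norm, norm_inner_symm, ← stft_eq_inner, ofReal_norm]
  simp_rw [e1, e2] at h1
  exact h1

lemma norm_eq_one (es : IsEigensystem g Ω lam h) {k : ℕ} (hk : 0 < lam k) : ‖h k‖ = 1 :=
  es.orthonormal.1 ⟨k, hk⟩

lemma setLIntegral_stft_self (es : IsEigensystem g Ω lam h) (hΩ : IsCompact Ω) (j : ℕ) :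
    ∫⁻ z in Ω, ‖stft g (h j) z‖ₑ ^ 2 = ENNReal.ofReal (lam j) := by
  rw [← es.tsum_eq hΩ, tsum_eq_single j]
  · rcases (es.nonneg j).eq_or_lt with hj | hj
    · simp [← hj]
    · have h1 : ‖(inner ℂ (h j) (h j) : ℂ)‖ₑ = 1 := by
        rw [← ofReal_norm, inner_self_eq_norm_sq_to_K, es.norm_eq_one hj]; simp
      rw [h1, one_pow, mul_one]
  · intro k hk
    rcases (es.nonneg k).eq_or_lt with hk0 | hk0
    · simp [← hk0]
    rcases (es.nonneg j).eq_or_lt with hj | hj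
    · simp [es.eq_zero j hj.symm]
    have := es.orthonormal.2 (i := ⟨k, hk0⟩) (j := ⟨j, hj⟩) (by simpa using hk)
    simp only at this
    simp [this]

lemma lintegral_stft_eq_one (es : IsEigensystem g Ω lam h) (hg : ‖g‖ = 1) {k : ℕ}
    (hk : 0 < lam k) : ∫⁻ z, ‖stft g (h k) z‖ₑ ^ 2 = 1 := by
  rw [lintegral_enorm_sq_stft, ← ofReal_norm, ← ofReal_norm, hg, es.norm_eq_one hk]
  simp

lemma measurable_stft_sq (g f : L2 d) : Measurable fun z => ‖stft g f z‖ₑ ^ 2 :=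
  (continuous_stft g f).measurable.enorm.pow_const 2

lemma lam_le_one (es : IsEigensystem g Ω lam h) (hg : ‖g‖ = 1) (hΩ : IsCompact Ω) (k : ℕ) :
    lam k ≤ 1 := by
  rcases (es.nonneg k).eq_or_lt with hk | hk
  · rw [← hk]; exact zero_le_one
  · have h1 := es.setLIntegral_stft_self hΩ k
    have h2 := (setLIntegral_le_lintegral (μ := volume) Ω fun z => ‖stft g (h k) z‖ₑ ^ 2)
    rw [h1, es.lintegral_stft_eq_one hg hk] at h2
    simpa using h2

/-- The trace of the localization operator. -/
lemma tsum_lam (es : IsEigensystem g Ω lam h) (hg : ‖g‖ = 1) (hΩ : IsCompact Ω) :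
    ∑' k, ENNReal.ofReal (lam k) = volume Ω := by
  have hm : Measurable fun p : Phase d × Phase d => ‖stft g g (p.2 - p.1)‖ₑ ^ 2 :=
    (measurable_stft_sq g g).comp (measurable_snd.sub measurable_fst)
  calc ∑' k, ENNReal.ofReal (lam k)
      = ∑' k, ∫⁻ z, ENNReal.ofReal (lam k) * ‖stft g (h k) z‖ₑ ^ 2 := by
        congr 1; ext k
        rw [lintegral_const_mul _ (measurable_stft_sq g _)]
        rcases (es.nonneg k).eq_or_lt with hk | hk
        · simp [← hk]
        · rw [es.lintegral_stft_eq_one hg hk, mul_one]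
    _ = ∫⁻ z, ∫⁻ w in Ω, ‖stft g g (w - z)‖ₑ ^ 2 := by
        rw [← lintegral_tsum fun k => ((measurable_stft_sq g _).const_mul _).aemeasurable]
        exact lintegral_congr fun z => es.tsum_stft hΩ z
    _ = ∫⁻ w in Ω, ∫⁻ z, ‖stft g g (w - z)‖ₑ ^ 2 := lintegral_lintegral_swap hm.aemeasurable
    _ = ∫⁻ w in Ω, 1 := by
        refine lintegral_congr fun w => ?_
        rw [lintegral_sub_left_eq_self (fun v => ‖stft g g v‖ₑ ^ 2) w, lintegral_enorm_sq_stft,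
          ← ofReal_norm, hg]
        simp
    _ = volume Ω := by simp

lemma setLIntegral_compl_stft (es : IsEigensystem g Ω lam h) (hg : ‖g‖ = 1) (hΩ : IsCompact Ω)
    {k : ℕ} (hk : 0 < lam k) :
    ∫⁻ z in Ωᶜ, ‖stft g (h k) z‖ₑ ^ 2 = ENNReal.ofReal (1 - lam k) := by
  have h1 := lintegral_add_compl (μ := volume) (fun z => ‖stft g (h k) z‖ₑ ^ 2) hΩ.measurableSet
  rw [es.setLIntegral_stft_self hΩ, es.lintegral_stft_eq_one hg hk] at h1
  rw [ENNReal.ofReal_sub _ hk.le, ENNReal.ofReal_one, ← h1,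
    ENNReal.add_sub_cancel_left ENNReal.ofReal_ne_top]

/-- Only an inequality, since beyond the last non-zero eigenvalue `h k = 0` and the two sides are 0
and 1. -/
lemma setLIntegral_compl_stft_le (es : IsEigensystem g Ω lam h) (hg : ‖g‖ = 1) (hΩ : IsCompact Ω)
    (k : ℕ) : ∫⁻ z in Ωᶜ, ‖stft g (h k) z‖ₑ ^ 2 ≤ ENNReal.ofReal (1 - lam k) := by
  rcases (es.nonneg k).eq_or_lt with hk | hk
  · have h0 : ∀ z, stft g (h k) z = 0 := fun z => by
      rw [stft_eq_inner, es.eq_zero k hk.symm, inner_zero_right]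
    simp [h0]
  · exact (es.setLIntegral_compl_stft hg hΩ hk).le

/-- `λ_k (1 - λ_k)` is `λ_k` times the mass of `|V_g h_k|²` outside `Ω`; summed over `k`, it becomes
the interaction of `Ω` with its complement. -/
lemma tsum_lam_mul_one_sub_le (es : IsEigensystem g Ω lam h) (hg : ‖g‖ = 1) (hΩ : IsCompact Ω)
    (hP : perimeter Ω < ∞) :
    ∑' k, ENNReal.ofReal (lam k * (1 - lam k)) ≤ mStarSq g * perimeter Ω := by
  calc ∑' k, ENNReal.ofReal (lam k * (1 - lam k))
      = ∑' k, ∫⁻ z in Ωᶜ, ENNReal.ofReal (lam k) * ‖stft g (h k) z‖ₑ ^ 2 := by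
        congr 1; ext k
        rw [lintegral_const_mul _ (measurable_stft_sq g _), ENNReal.ofReal_mul (es.nonneg k)]
        rcases (es.nonneg k).eq_or_lt with hk | hk
        · simp [← hk]
        · rw [es.setLIntegral_compl_stft hg hΩ hk]
    _ = ∫⁻ z in Ωᶜ, ∫⁻ w in Ω, ‖stft g g (w - z)‖ₑ ^ 2 := by
        rw [← lintegral_tsum fun k => ((measurable_stft_sq g _).const_mul _).aemeasurable]
        exact lintegral_congr fun z => es.tsum_stft hΩ z
    _ ≤ (∫⁻ v, ENNReal.ofReal ‖v‖ * ‖stft g g v‖ₑ ^ 2) * perimeter Ω :=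
        lintegral_compl_lintegral_le hΩ hP (measurable_stft_sq g g)
    _ = mStarSq g * perimeter Ω := by
        rw [mStarSq]
        congr 1
        refine lintegral_congr fun v => ?_
        rw [ENNReal.ofReal_mul (norm_nonneg _), ENNReal.ofReal_pow (norm_nonneg _), ofReal_norm (stft g g v)]

lemma accSpec_nonneg (g : L2 d) (Ω : Set (Phase d)) (h : ℕ → L2 d) (z : Phase d) :
    0 ≤ accSpec g Ω h z := Finset.sum_nonneg fun _ _ => by positivity

/-- Bessel's inequality for the unit vector `atom g z`; the zero vectors that pad the system
contribute nothing. -/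
lemma accSpec_le_one (es : IsEigensystem g Ω lam h) (hg : ‖g‖ = 1) (z : Phase d) :
    accSpec g Ω h z ≤ 1 := by
  classical
  set N := ⌈(volume : Measure (Phase d)).real Ω⌉₊ with hN
  have h1 := es.orthonormal.sum_inner_products_le (x := atom g z)
    (s := (Finset.range N).subtype fun k => 0 < lam k)
  rw [norm_atom, hg, one_pow] at h1
  refine le_trans (le_of_eq ?_) h1
  rw [Finset.sum_subtype_eq_sum_filter (s := Finset.range N)
    (f := fun k => ‖(inner ℂ (h k) (atom g z) : ℂ)‖ ^ 2), accSpec, ← hN, Finset.sum_filter]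
  refine Finset.sum_congr rfl fun k _ => ?_
  split_ifs with hk
  · rw [stft_eq_inner, norm_inner_symm]
  · have := es.eq_zero k (le_antisymm (not_lt.1 hk) (es.nonneg k))
    rw [stft_eq_inner, this]; simp

lemma continuous_accSpec (g : L2 d) (Ω : Set (Phase d)) (h : ℕ → L2 d) :
    Continuous (accSpec g Ω h) :=
  continuous_finsetSum _ fun k _ => (continuous_stft g (h k)).norm.pow 2

lemma ofReal_accSpec (g : L2 d) (Ω : Set (Phase d)) (h : ℕ → L2 d) (z : Phase d) :
    ENNReal.ofReal (accSpec g Ω h z) =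
      ∑ k ∈ Finset.range ⌈(volume : Measure (Phase d)).real Ω⌉₊, ‖stft g (h k) z‖ₑ ^ 2 := by
  rw [accSpec, ENNReal.ofReal_sum_of_nonneg fun _ _ => by positivity]
  refine Finset.sum_congr rfl fun k _ => ?_
  rw [ENNReal.ofReal_pow (norm_nonneg _), ofReal_norm]

/-- The `L¹` distance of the accumulated spectrogram to the characteristic function. -/
lemma lintegral_accSpec_sub_le (es : IsEigensystem g Ω lam h) (hg : ‖g‖ = 1) (hΩ : IsCompact Ω)
    (hM : mStarSq g < ∞) (hP : perimeter Ω < ∞) :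
    ∫⁻ z, ‖accSpec g Ω h z - Ω.indicator (fun _ => (1 : ℝ)) z‖ₑ ≤
      1 + 2 * (mStarSq g * perimeter Ω) := by
  have hΩm := hΩ.measurableSet
  set a := (volume : Measure (Phase d)).real Ω with ha
  set N := ⌈a⌉₊ with hN
  have hPfin : mStarSq g * perimeter Ω ≠ ∞ := ENNReal.mul_ne_top hM.ne hP.ne
  have h0 := es.nonneg
  have h1 := es.lam_le_one hg hΩ
  have hq0 : ∀ k, 0 ≤ lam k * (1 - lam k) := fun k => mul_nonneg (h0 k) (by linarith [h1 k])
  have hsum : HasSum lam a := by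
    have := ENNReal.hasSum_toReal (f := fun k => ENNReal.ofReal (lam k))
      (by rw [es.tsum_lam hg hΩ]; exact hΩ.measure_lt_top.ne)
    rw [← ENNReal.tsum_toReal_eq fun k => ENNReal.ofReal_ne_top, es.tsum_lam hg hΩ] at this
    simp only [ENNReal.toReal_ofReal (h0 _)] at this
    exact this
  have hS := es.tsum_lam_mul_one_sub_le hg hΩ hP
  have hSsum : Summable fun k => lam k * (1 - lam k) := by
    have := ENNReal.summable_toReal (ne_top_of_le_ne_top hPfin hS)
    simpa only [ENNReal.toReal_ofReal (hq0 _)] using this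
  have htail := tail_le_of_hasSum es.antitone h0 h1 hsum hSsum.hasSum (Nat.le_ceil a)
  rw [← hN] at htail
  have hNa : (N : ℝ) ≤ a + 1 := (Nat.ceil_lt_add_one measureReal_nonneg).le
  have hin : ∫⁻ z in Ω, ‖accSpec g Ω h z - Ω.indicator (fun _ => (1 : ℝ)) z‖ₑ =
      ENNReal.ofReal (a - ∑ k ∈ Finset.range N, lam k) := by
    have e1 : ∫⁻ z in Ω, ENNReal.ofReal (accSpec g Ω h z) =
        ENNReal.ofReal (∑ k ∈ Finset.range N, lam k) := by
      simp_rw [ofReal_accSpec]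
      rw [lintegral_finsetSum _ fun k _ => measurable_stft_sq g _,
        ENNReal.ofReal_sum_of_nonneg fun k _ => h0 k]
      exact Finset.sum_congr rfl fun k _ => es.setLIntegral_stft_self hΩ k
    rw [ENNReal.ofReal_sub _ (Finset.sum_nonneg fun k _ => h0 k), ← e1, ha, ofReal_measureReal hΩ.measure_lt_top.ne]
    have e2 : volume Ω = ∫⁻ z in Ω, ENNReal.ofReal 1 := by simp
    rw [e2, ← lintegral_sub (continuous_accSpec g Ω h).measurable.ennreal_ofReal
      (by rw [e1]; exact ENNReal.ofReal_ne_top)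
      (ae_of_all _ fun z => ENNReal.ofReal_le_ofReal (es.accSpec_le_one hg z))]
    refine setLIntegral_congr_fun hΩm fun z hz => ?_
    simp only [Set.indicator_of_mem hz]
    rw [← ENNReal.ofReal_sub _ (accSpec_nonneg g Ω h z), ← ofReal_norm, Real.norm_eq_abs,
      abs_sub_comm, abs_of_nonneg (sub_nonneg.2 (es.accSpec_le_one hg z))]
  have hout : ∫⁻ z in Ωᶜ, ‖accSpec g Ω h z - Ω.indicator (fun _ => (1 : ℝ)) z‖ₑ ≤
      ENNReal.ofReal (∑ k ∈ Finset.range N, (1 - lam k)) := by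
    calc _ = ∫⁻ z in Ωᶜ, ENNReal.ofReal (accSpec g Ω h z) := by
          refine setLIntegral_congr_fun hΩm.compl fun z hz => ?_
          simp only [Set.indicator_of_notMem hz, sub_zero]
          rw [← ofReal_norm, Real.norm_of_nonneg (accSpec_nonneg g Ω h z)]
      _ ≤ _ := by
          simp_rw [ofReal_accSpec]
          rw [lintegral_finsetSum _ fun k _ => measurable_stft_sq g _,
            ENNReal.ofReal_sum_of_nonneg fun k _ => by linarith [h1 k]]
          exact Finset.sum_le_sum fun k _ => es.setLIntegral_compl_stft_le hg hΩ k
  have htn : 0 ≤ a - ∑ k ∈ Finset.range N, lam k :=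
    sub_nonneg.2 (sum_le_hasSum _ (fun k _ => h0 k) hsum)
  rw [← lintegral_add_compl _ hΩm, hin]
  refine (add_le_add_right hout _).trans ?_
  rw [← ENNReal.ofReal_add htn (Finset.sum_nonneg fun k _ => by linarith [h1 k])]
  have hSr : ∑' k, lam k * (1 - lam k) ≤ (mStarSq g * perimeter Ω).toReal := by
    rw [← ENNReal.ofReal_le_iff_le_toReal hPfin, ENNReal.ofReal_tsum_of_nonneg hq0 hSsum]
    exact hS
  rw [← ENNReal.ofReal_toReal hPfin, ← ENNReal.ofReal_ofNat, ← ENNReal.ofReal_mul (by norm_num),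
    ← ENNReal.ofReal_one, ← ENNReal.ofReal_add zero_le_one (by positivity)]
  refine ENNReal.ofReal_le_ofReal ?_
  -- With `σ = ∑_{k<N} λ_k`, the total `(a - σ) + (N - σ)` is at most `1 + 2 (a - σ)` because `N ≤ a
  -- + 1`.
  rw [Finset.sum_sub_distrib, Finset.sum_const, Finset.card_range, nsmul_eq_mul]
  linarith

/-- The weak-type estimate for accumulated spectrograms. -/
lemma volume_accSpec_sub_le (es : IsEigensystem g Ω lam h) (hg : ‖g‖ = 1) (hΩ : IsCompact Ω)
    (hM : mStarSq g < ∞) (hP : perimeter Ω < ∞) (hMP : 1 ≤ mStarSq g * perimeter Ω)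
    {δ : ℝ} (hδ : 0 < δ) :
    volume {z : Phase d | δ < |accSpec g Ω h z - Ω.indicator (fun _ => (1 : ℝ)) z|} ≤
      ENNReal.ofReal (3 / δ ^ 2) * (mStarSq g * perimeter Ω) := by
  -- Since the deviation never exceeds 1, only `δ < 1` matters, and there the bound of order `1/δ`
  -- from Markov's inequality is stronger than `1/δ²`.
  rcases le_or_gt 1 δ with hδ1 | hδ1
  · have hempty : {z : Phase d | δ < |accSpec g Ω h z - Ω.indicator (fun _ => (1 : ℝ)) z|} = ∅ := by
      refine Set.eq_empty_of_forall_notMem fun z hz => ?_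
      refine absurd (lt_of_le_of_lt hδ1 hz) (not_lt.2 ?_)
      have b0 := accSpec_nonneg g Ω h z
      have b1 := es.accSpec_le_one hg z
      by_cases hzΩ : z ∈ Ω
      · rw [Set.indicator_of_mem hzΩ, abs_le]; constructor <;> linarith
      · rw [Set.indicator_of_notMem hzΩ, abs_le]; constructor <;> linarith
    rw [hempty]; simp
  · have hm : Measurable fun z => ‖accSpec g Ω h z - Ω.indicator (fun _ => (1 : ℝ)) z‖ₑ :=
      ((continuous_accSpec g Ω h).measurable.sub
        (measurable_const.indicator hΩ.measurableSet)).enorm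
    calc _ ≤ volume {z : Phase d | ENNReal.ofReal δ ≤
            ‖accSpec g Ω h z - Ω.indicator (fun _ => (1 : ℝ)) z‖ₑ} := by
          refine measure_mono fun z hz => ?_
          rw [Set.mem_ofPred_eq, ← ofReal_norm]
          exact ENNReal.ofReal_le_ofReal (le_of_lt hz)
      _ ≤ (∫⁻ z, ‖accSpec g Ω h z - Ω.indicator (fun _ => (1 : ℝ)) z‖ₑ) / ENNReal.ofReal δ :=
          meas_ge_le_lintegral_div hm.aemeasurable (by simpa using hδ) ENNReal.ofReal_ne_top
      _ ≤ 3 * (mStarSq g * perimeter Ω) / ENNReal.ofReal δ := by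
          gcongr
          refine (es.lintegral_accSpec_sub_le hg hΩ hM hP).trans ?_
          calc 1 + 2 * (mStarSq g * perimeter Ω)
              ≤ mStarSq g * perimeter Ω + 2 * (mStarSq g * perimeter Ω) := by gcongr
            _ = 3 * (mStarSq g * perimeter Ω) := by ring
      _ = ENNReal.ofReal (3 / δ) * (mStarSq g * perimeter Ω) := by
          rw [ENNReal.ofReal_div_of_pos hδ, ENNReal.ofReal_ofNat, mul_comm, mul_div_assoc, mul_comm]
      _ ≤ _ := by
          gcongr
          nlinarith

end IsEigensystem

end

/-! ### Existence of the ordered diagonalization. -/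

section

open Filter Topology

/-- A summable family of positive numbers can be enumerated in non-increasing order by an initial
segment of `ℕ`. -/
lemma exists_rank {ι : Type*} {l : ι → ℝ} (hl : ∀ i, 0 < l i) (hs : Summable l) :
    ∃ r : ι → ℕ, Function.Injective r ∧ (∀ i m, m < r i → ∃ j, r j = m) ∧
      ∀ i j, r j ≤ r i → l i ≤ l j := by
  have : Countable ι := by
    refine Set.countable_univ_iff.1 (hs.countable_support.mono fun i _ => ?_)
    exact (hl i).ne'
  obtain ⟨enc, henc⟩ := exists_injective_nat ι
  -- Order by decreasing value, ties broken by an enumeration. Summability makes initial segments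
  -- finite, so the rank of `i` can be the number of its predecessors.
  let key : ι → ℝᵒᵈ ×ₗ ℕ := fun i => toLex (OrderDual.toDual (l i), enc i)
  have hkey : Function.Injective key := fun i j hij => henc (congrArg (fun p => (ofLex p).2) hij)
  let _ : LinearOrder ι := LinearOrder.lift' key hkey
  have hle : ∀ i j : ι, i ≤ j → l j ≤ l i := fun i j hij => by
    have h : key i ≤ key j := hij
    rcases (Prod.Lex.le_iff).1 h with h | h
    · exact (OrderDual.toDual_lt_toDual.1 h).le
    · exact (OrderDual.toDual_le_toDual.1 h.1.le)
  have hfin : ∀ i, (Set.Iio i).Finite := fun i => by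
    have h := hs.tendsto_cofinite_zero.eventually (gt_mem_nhds (hl i))
    refine (Filter.eventually_cofinite.1 h).subset fun j hj => ?_
    simpa using hle j i (le_of_lt hj)
  let r : ι → ℕ := fun i => (Set.Iio i).ncard
  have hr : StrictMono r := fun i j hij =>
    Set.ncard_lt_ncard (Set.Iio_ssubset_Iio hij) (hfin j)
  refine ⟨r, hr.injective, ?_, fun i j hij => hle j i (hr.le_iff_le.1 hij)⟩
  have main : ∀ n i, r i = n → ∀ m < n, ∃ j, r j = m := by
    intro n
    induction n with
    | zero => intro i _ m hm; omega
    | succ n ih =>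
      intro i hi m hm
      have hne : (Set.Iio i).Nonempty := by
        rw [← Set.ncard_pos (hfin i)]
        exact (Nat.succ_pos n).trans_eq hi.symm
      obtain ⟨j, hj, hmax⟩ := (hfin i).exists_maximalFor id _ hne
      have heq : Set.Iio i = insert j (Set.Iio j) := by
        ext k
        simp only [Set.mem_Iio, Set.mem_insert_iff]
        constructor
        · intro hk
          rcases lt_trichotomy k j with h | h | h
          · exact Or.inr h
          · exact Or.inl h
          · exact absurd (hmax hk h.le) (not_le.2 h)
        · rintro (rfl | h)
          · exact hj
          · exact h.trans hj
      have hrj : r i = r j + 1 := by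
        change (Set.Iio i).ncard = _
        rw [heq, Set.ncard_insert_of_notMem (by simp) (hfin j)]
      rcases Nat.lt_succ_iff_lt_or_eq.1 hm with h | h
      · exact ih j (by omega) m h
      · exact ⟨j, by omega⟩
  exact fun i m hm => main _ i rfl m hm

universe u

/-- Hilbert bases of an orthogonal family of complete subspaces with trivial orthogonal complement
combine to a Hilbert basis of the whole space. -/
lemma exists_hilbertBasis_of_orthogonalFamily {E κ : Type u} [NormedAddCommGroup E]
    [InnerProductSpace ℂ E] [CompleteSpace E] (V : κ → Submodule ℂ E)
    (hVc : ∀ μ, CompleteSpace (V μ)) (hV : OrthogonalFamily ℂ (fun μ => V μ) fun μ => (V μ).subtypeₗᵢ)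
    (hbot : (⨆ μ, V μ)ᗮ = ⊥) :
    ∃ (ι : Type u) (b : HilbertBasis ι ℂ E) (k : ι → κ), ∀ i, b i ∈ V (k i) := by
  choose w b hb using fun μ => exists_hilbertBasis ℂ (V μ)
  have hon : Orthonormal ℂ fun p : Σ μ, w μ => ((b p.1 p.2 : V p.1) : E) :=
    hV.orthonormal_sigma_orthonormal (v_family := fun μ i => b μ i) fun μ => (b μ).orthonormal
  have hsp : (Submodule.span ℂ (Set.range fun p : Σ μ, w μ => ((b p.1 p.2 : V p.1) : E)))ᗮ = ⊥ := by
    rw [eq_bot_iff, ← hbot]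
    intro x hx
    rw [Submodule.mem_orthogonal'] at hx
    rw [← Submodule.iInf_orthogonal, Submodule.mem_iInf]
    refine fun μ => (Submodule.mem_orthogonal' _ _).2 fun y hy => ?_
    -- Expanding `y` in the basis of `V μ` shows that `x`, orthogonal to every basis vector, is
    -- orthogonal to `y`.
    have h1 := (((b μ).hasSum_repr ⟨y, hy⟩).mapL (V μ).subtypeL).mapL (innerSL ℂ x)
    refine h1.unique (hasSum_zero.congr_fun fun i => ?_)
    have h2 := hx _ (Submodule.subset_span ⟨⟨μ, i⟩, rfl⟩)
    simp [h2]
  refine ⟨_, HilbertBasis.mkOfOrthogonalEqBot hon hsp, fun p => p.1, fun p => ?_⟩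
  rw [HilbertBasis.coe_mkOfOrthogonalEqBot]
  exact (b p.1 p.2).2

/-- The **spectral theorem** for compact symmetric operators: there is a Hilbert basis of
eigenvectors. -/
lemma exists_hilbertBasis_eigenvectors {E : Type} [NormedAddCommGroup E] [InnerProductSpace ℂ E]
    [CompleteSpace E] {T : E →L[ℂ] E} (hT : IsCompactOperator T)
    (hT' : (T : E →ₗ[ℂ] E).IsSymmetric) :
    ∃ (ι : Type) (b : HilbertBasis ι ℂ E) (μ : ι → ℂ), ∀ i, T (b i) = μ i • b i := by
  have hVc : ∀ μ, CompleteSpace (Module.End.eigenspace (T : E →ₗ[ℂ] E) μ) := fun μ => by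
    have h : (Module.End.eigenspace (T : E →ₗ[ℂ] E) μ : Set E) = {x | T x = μ • x} := by
      ext x; exact Module.End.mem_eigenspace_iff
    have hc : IsClosed (Module.End.eigenspace (T : E →ₗ[ℂ] E) μ : Set E) := by
      rw [h]
      exact isClosed_eq T.continuous (continuous_const_smul μ)
    exact hc.completeSpace_coe
  obtain ⟨ι, b, μ, hb⟩ := exists_hilbertBasis_of_orthogonalFamily _ hVc
    hT'.orthogonalFamily_eigenspaces
    (ContinuousLinearMap.orthogonalComplement_iSup_eigenspaces_eq_bot hT hT')
  exact ⟨ι, b, μ, fun i => Module.End.mem_eigenspace_iff.1 (hb i)⟩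

/-- The eigenvectors of a diagonal operator with summable non-negative eigenvalues, arranged by
non-increasing eigenvalues. -/
lemma exists_ordered_diagonalization {E ι : Type*} [NormedAddCommGroup E] [InnerProductSpace ℂ E]
    {T : E →L[ℂ] E} (b : HilbertBasis ι ℂ E) {l : ι → ℝ} (hl0 : ∀ i, 0 ≤ l i) (hls : Summable l)
    (hb : ∀ i, T (b i) = (l i : ℂ) • b i) :
    ∃ (lam : ℕ → ℝ) (h : ℕ → E), (∀ k, 0 ≤ lam k) ∧ Antitone lam ∧
      Orthonormal ℂ (fun k : {k : ℕ // 0 < lam k} => h k) ∧ (∀ k, lam k = 0 → h k = 0) ∧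
      ∀ f, HasSum (fun k : ℕ => ((lam k : ℂ) * inner ℂ (h k) f) • h k) (T f) := by
  -- The kernel is discarded before ranking; positions not attained by the rank are filled with
  -- zeros, as `IsEigensystem` demands.
  let ι' := {i : ι // 0 < l i}
  obtain ⟨r, hr, hdown, hmono⟩ := exists_rank (l := fun i : ι' => l i) (fun i => i.2)
    (hls.subtype _)
  let lam : ℕ → ℝ := Function.extend r (fun i : ι' => l i) 0
  let h : ℕ → E := Function.extend r (fun i : ι' => b i) 0
  have hlam : ∀ i, lam (r i) = l i := fun i => hr.extend_apply _ _ i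
  have hh : ∀ i, h (r i) = b i := fun i => hr.extend_apply _ _ i
  have hlam' : ∀ n, (¬ ∃ i, r i = n) → lam n = 0 := fun n hn => Function.extend_apply' _ _ n hn
  have hh' : ∀ n, (¬ ∃ i, r i = n) → h n = 0 := fun n hn => Function.extend_apply' _ _ n hn
  have hnn : ∀ k, 0 ≤ lam k := fun k => by
    by_cases hk : ∃ i, r i = k
    · obtain ⟨i, rfl⟩ := hk; rw [hlam]; exact hl0 _
    · rw [hlam' k hk]
  refine ⟨lam, h, hnn, ?_, ?_, ?_, ?_⟩
  · intro m n hmn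
    by_cases hn : ∃ i, r i = n
    · obtain ⟨i, rfl⟩ := hn
      obtain ⟨j, rfl⟩ : ∃ j, r j = m := by
        rcases hmn.eq_or_lt with h | h
        · exact ⟨i, h.symm⟩
        · exact hdown i m h
      rw [hlam, hlam]
      exact hmono i j hmn
    · rw [hlam' n hn]; exact hnn m
  · have hex : ∀ k : {k : ℕ // 0 < lam k}, ∃ i, r i = k := fun k => by
      by_contra hk
      exact k.2.ne' (hlam' _ hk)
    choose σ hσ using hex
    have hσi : Function.Injective fun k => (σ k : ι) := fun k k' hkk => by
      have : σ k = σ k' := Subtype.ext hkk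
      exact Subtype.ext (by rw [← hσ k, ← hσ k', this])
    have : (fun k : {k : ℕ // 0 < lam k} => h k) = b ∘ fun k => (σ k : ι) := by
      ext1 k
      simp only [Function.comp_apply]
      rw [← hh, hσ]
    rw [this]
    exact b.orthonormal.comp _ hσi
  · intro k hk
    refine hh' k ?_
    rintro ⟨i, rfl⟩
    rw [hlam] at hk
    exact i.2.ne' hk
  · intro f
    have h1 := (b.hasSum_repr f).mapL T
    simp only [map_smul, hb, b.repr_apply_apply, smul_smul] at h1
    have h2 : HasSum (fun i : ι' => (inner ℂ (b i) f * (l i : ℂ)) • b i) (T f) := by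
      refine (hasSum_subtype_iff_of_support_subset (s := {i | 0 < l i}) fun i hi => ?_).2 h1
      rcases (hl0 i).eq_or_lt with h0 | h0
      · exact absurd (by simp [← h0]) hi
      · exact h0
    rw [← hr.hasSum_iff]
    · refine h2.congr_fun fun i => ?_
      simp only [Function.comp_apply]
      rw [hlam, hh, mul_comm]
    · intro n hn
      rw [hh' n (by simpa using hn), smul_zero]

variable {d : ℕ} {g : L2 d} {Ω : Set (Phase d)}

/-- Bessel's inequality for `atom g z`, integrated over `Ω`, bounds every partial sum by `‖g‖² |Ω|`.
-/
lemma summable_eigenvalues {ι : Type*} (b : HilbertBasis ι ℂ (L2 d)) (g : L2 d)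
    (hΩ : IsCompact Ω) : Summable fun i => ∫ z in Ω, ‖stft g (b i) z‖ ^ 2 := by
  have hi : ∀ i, IntegrableOn (fun z => ‖stft g (b i) z‖ ^ 2) Ω := fun i =>
    ((continuous_stft g (b i)).norm.pow 2).continuousOn.integrableOn_compact hΩ
  refine summable_of_sum_le (c := ∫ z in Ω, ‖g‖ ^ 2)
    (fun i => integral_nonneg fun z => by positivity) fun s => ?_
  rw [← integral_finsetSum _ fun i _ => hi i]
  refine setIntegral_mono (integrable_finsetSum _ fun i _ => hi i)
    (integrableOn_const hΩ.measure_lt_top.ne) fun z => ?_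
  have := b.orthonormal.sum_inner_products_le (x := atom g z) (s := s)
  rw [norm_atom] at this
  refine le_of_eq_of_le (Finset.sum_congr rfl fun i _ => ?_) this
  rw [stft_eq_inner, norm_inner_symm]

theorem exists_isEigensystem (g : L2 d) (hΩ : IsCompact Ω) :
    ∃ (lam : ℕ → ℝ) (h : ℕ → L2 d), IsEigensystem g Ω lam h := by
  obtain ⟨ι, b, μ, hb⟩ := exists_hilbertBasis_eigenvectors (isCompactOperator_locOp g hΩ)
    (isSymmetric_locOp g hΩ)
  have hμ : ∀ i, μ i = ((∫ z in Ω, ‖stft g (b i) z‖ ^ 2 : ℝ) : ℂ) := fun i => by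
    have := inner_locOp_self g hΩ (b i)
    rw [hb, inner_smul_right, inner_self_eq_norm_sq_to_K, b.orthonormal.1 i] at this
    simpa using this
  obtain ⟨lam, h, h1, h2, h3, h4, h5⟩ := exists_ordered_diagonalization b
    (fun i => integral_nonneg fun z => by positivity) (summable_eigenvalues b g hΩ)
    (fun i => (hb i).trans (by rw [hμ]))
  exact ⟨lam, h, h1, h2, h3, h4, fun f => ⟨locOp g Ω f, locOp_ae_eq g hΩ f, h5 f⟩⟩

end

end AccSpec

end

theorem theorem1p5 :
    ∃ C : ℝ, 0 < C ∧
      ∀ (d : ℕ) (g : AccSpec.L2 d) (Ω : Set (AccSpec.Phase d)),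
        ‖g‖ = 1 → AccSpec.mStarSq g < ∞ →
        IsCompact Ω → AccSpec.perimeter Ω < ∞ →
        1 ≤ AccSpec.mStarSq g * AccSpec.perimeter Ω →
        (∃ (lam : ℕ → ℝ) (h : ℕ → AccSpec.L2 d), AccSpec.IsEigensystem g Ω lam h) ∧
        ∀ (lam : ℕ → ℝ) (h : ℕ → AccSpec.L2 d), AccSpec.IsEigensystem g Ω lam h →
          ∀ δ : ℝ, 0 < δ →
            volume {z : AccSpec.Phase d |
                δ < |AccSpec.accSpec g Ω h z - Ω.indicator (fun _ => (1 : ℝ)) z|} ≤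
              ENNReal.ofReal (C / δ ^ 2) * (AccSpec.mStarSq g * AccSpec.perimeter Ω) := by
  -- The constant is `3 = 1 + 2`: the additive 1 in the `L¹` bound is absorbed using `‖g‖²_{M*} |∂Ω|
  -- ≥ 1`.
  refine ⟨3, by norm_num, fun d g Ω hg hM hΩ hP hMP =>
    ⟨AccSpec.exists_isEigensystem g hΩ, fun lam h es δ hδ => ?_⟩⟩
  exact es.volume_accSpec_sub_le hg hΩ hM hP hMP hδ
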